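/- Let $W=\{W(x,t)\}_{(x,t)\in\mathbb R^2}$ be a real, zero mean, stationary Gaussian field with almost surely continuously differentiable sample paths, and assume that the Gaussian vector $(W,W_x,W_t)(0,0)$ is nondegenerate. Let $f$ be its joint normal density. Let $v\in\mathbb R$ be the velocity of a ship, let $Z(t)=W(vt,t)$ be the sea surface encountered by the ship, and define the distribution function of the slope at overtaking wave centers as the Palm distribution $$F^{\mathrm{enc}}_{W_x}(w)=\frac{\mathbb E\big[\#\{t\in[0,1]:\,Z(t)=0,\ Z_t(t)>0,\ W_x(vt,t)<0,\ W_x(vt,t)\le w\}\big]}{\mathbb E\big[\#\{t\in[0,1]:\,Z(t)=0,\ Z_t(t)>0,\ W_x(vt,t)<0\}\big]},\qquad w\in\mathbb R .$$ Let $V=-W_t(0,0)/W_x(0,0)$ be the local wave velocity at $(x,t)=(0,0)$, and write $y^+=\max(y,0)$, $y^-=\max(-y,0)$. For a function $g$, the expression $\mathbb E[g(W_x(0,0),W_t(0,0))\mid W(0,0)=0]\,f_{W(0,0)}(0)$ denotes the integral $\iint g(a,b)\,f(0,a,b)\,da\,db$ (and $(V-v)^+W_x(0,0)^-$ is read as $0$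 where $W_x(0,0)=0$). Then the denominator of $F^{\mathrm{enc}}_{W_x}$ is positive and finite and, for every $w\in\mathbb R$, $$F^{\mathrm{enc}}_{W_x}(w)=\frac{\mathbb E\big[(V-v)^+\,W_x(0,0)^-\,\mathbf 1_{\{W_x(0,0)\le w\}}\mid W(0,0)=0\big]\,f_{W(0,0)}(0)}{\mathbb E\big[(V-v)^+\,W_x(0,0)^-\mid W(0,0)=0\big]\,f_{W(0,0)}(0)},$$ where the denominator on the right-hand side is positive. -/

import Mathlib

open MeasureTheory ProbabilityTheory Set
open scoped ENNReal

namespace GaussianSea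

noncomputable section

variable {Ω : Type*} [MeasurableSpace Ω]

/-- Strict stationarity of a random field on the plane of points `(x, t)`: all finite-dimensional
distributions are invariant under translations. -/
def IsStationary (W : ℝ × ℝ → Ω → ℝ) (P : Measure Ω) : Prop :=
  ∀ (h : ℝ × ℝ) (n : ℕ) (p : Fin n → ℝ × ℝ),
    IdentDistrib (fun ω i => W (p i + h) ω) (fun ω i => W (p i) ω) P P

/-- A zero mean, stationary Gaussian field `W (x, t)` whose sample paths are almost surely
continuously differentiable functions of `(x, t)`. -/
structure IsGaussianSea (W : ℝ × ℝ → Ω → ℝ) (P : Measure Ω) : Prop where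
  gaussian : IsGaussianProcess W P
  mean_zero : ∀ p, ∫ ω, W p ω ∂P = 0
  stationary : IsStationary W P
  contDiff : ∀ᵐ ω ∂P, ContDiff ℝ 1 (fun p : ℝ × ℝ => W p ω)

/-- The partial derivative `W_x (x, t)` in space (the slope). -/
def Wx (W : ℝ × ℝ → Ω → ℝ) (x t : ℝ) (ω : Ω) : ℝ := deriv (fun y => W (y, t) ω) x

/-- The partial derivative `W_t (x, t)` in time. -/
def Wt (W : ℝ × ℝ → Ω → ℝ) (x t : ℝ) (ω : Ω) : ℝ := deriv (fun s => W (x, s) ω) t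

/-- The encountered sea `Z (t) = W (v t, t)`. -/
def encSea (W : ℝ × ℝ → Ω → ℝ) (v : ℝ) (t : ℝ) (ω : Ω) : ℝ := W (v * t, t) ω

/-- The times `t ∈ [0, 1]` at which a wave center overtakes the ship, that is `Z (t) = 0`,
`Z_t (t) > 0` and `W_x (v t, t) < 0`. -/
def overtakingTimes (W : ℝ × ℝ → Ω → ℝ) (v : ℝ) (ω : Ω) : Set ℝ :=
  {t | t ∈ Icc (0 : ℝ) 1 ∧ encSea W v t ω = 0 ∧ 0 < deriv (fun s => encSea W v s ω) t ∧
    Wx W (v * t) t ω < 0}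

/-- The expected number of overtaking times in `[0, 1]`. -/
def encIntensity (W : ℝ × ℝ → Ω → ℝ) (P : Measure Ω) (v : ℝ) : ℝ≥0∞ :=
  ∫⁻ ω, ((overtakingTimes W v ω).encard : ℝ≥0∞) ∂P

/-- The expected number of overtaking times in `[0, 1]` at which the slope is at most `w`. -/
def encIntensityLe (W : ℝ × ℝ → Ω → ℝ) (P : Measure Ω) (v w : ℝ) : ℝ≥0∞ :=
  ∫⁻ ω, ((overtakingTimes W v ω ∩ {t | Wx W (v * t) t ω ≤ w}).encard : ℝ≥0∞) ∂P

/-- The Palm distribution function of the slope at encountered overtaking wave centers. -/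
def encSlopeCDF (W : ℝ × ℝ → Ω → ℝ) (P : Measure Ω) (v w : ℝ) : ℝ :=
  (encIntensityLe W P v w / encIntensity W P v).toReal

/-- The density of the (nondegenerate) normal distribution with mean `m` and covariance
matrix `S`. -/
def normalDensity {n : ℕ} (m : Fin n → ℝ) (S : Matrix (Fin n) (Fin n) ℝ) (x : Fin n → ℝ) : ℝ :=
  Real.exp (-((x - m) ⬝ᵥ (S⁻¹.mulVec (x - m))) / 2) / Real.sqrt ((2 * Real.pi) ^ n * S.det)

/-- The vector of means of a finite family of random variables. -/
def meanVec {n : ℕ} (X : Fin n → Ω → ℝ) (P : Measure Ω) : Fin n → ℝ :=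
  fun i => ∫ ω, X i ω ∂P

/-- The covariance matrix of a finite family of random variables. -/
def covMatrix {n : ℕ} (X : Fin n → Ω → ℝ) (P : Measure Ω) : Matrix (Fin n) (Fin n) ℝ :=
  Matrix.of fun i j => cov[X i, X j; P]

/-- The random vector `(W, W_x, W_t)` at `(x, t) = (0, 0)`. -/
def jet (W : ℝ × ℝ → Ω → ℝ) : Fin 3 → Ω → ℝ :=
  ![W (0, 0), Wx W 0 0, Wt W 0 0]

/-- `E[g (W_x (0,0), W_t (0,0)) | W (0,0) = u] * f_{W (0,0)} (u)`, read as the integral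
`∫∫ g (a, b) f (u, a, b) da db`, where `f` is the joint (normal) density of
`(W, W_x, W_t)` at `(0, 0)`. -/
def condExpMulDensity (W : ℝ × ℝ → Ω → ℝ) (P : Measure Ω) (g : ℝ → ℝ → ℝ) (u : ℝ) : ℝ :=
  ∫ y : ℝ × ℝ, g y.1 y.2 *
    normalDensity (meanVec (jet W) P) (covMatrix (jet W) P) ![u, y.1, y.2]

/-- The local velocity `V = - W_t / W_x` as a function of the values `a = W_x` and `b = W_t`.
It is only used with the weight `a⁻`, which vanishes at `a = 0`. -/
def velocity (a b : ℝ) : ℝ := -b / a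

end

end GaussianSea

/-!
On a dyadic grid, count the cells over which the encountered sea `Z (t) = W (v t, t)` steps up from
`Z ≤ 0` to `Z > 0`, marking each step with difference quotients of `W` in `x` and in `t`. By
stationarity the expected count of steps with mark in `A` is the number of cells times the
probability of such a step over the first one, and this depends on the three-dimensional Gaussian
vector formed by `W (0, 0)` and the mark only. Its covariance matrix converges to that of
`(W, W_x, W_t)`, so that after rescaling the value by the step the expected count converges to
`∫_A (v a + b)⁺ f (0, a, b) d(a, b)`.

For a `C¹` path the upcrossings with mark in an open set are at most the limit inferior of the
counts, and, where the derivative stays positive, those with mark in a closed set are eventually at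
least the counts. Fatou's lemma in both directions and regularity of the limit measure give Rice's
formula for every measurable set of marks. Finally `(V - v)⁺ a⁻ = (v a + b)⁺` when `a < 0`.
-/

namespace GaussianSea

open Filter Topology

section Counting

variable {M : Type*} {Z Z' : ℝ → ℝ} {m : ℝ → ℝ → M} {m₀ : ℝ → M} {A : Set M}

/-- The function `Z` crosses zero upwards between `s` and `s + h`, and the mark `m h s` attached to
this step lies in `A`. -/
def UpStep (Z : ℝ → ℝ) (m : ℝ → ℝ → M) (A : Set M) (h s : ℝ) : Prop :=
  Z s ≤ 0 ∧ 0 < Z (s + h) ∧ m h s ∈ A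

open Classical in
/-- The indices `k` of the cells `[k / 2ⁿ, (k + 1) / 2ⁿ]` of the `n`-th dyadic grid of `[0, 1]` over
which `Z` makes an up-step with mark in `A`. -/
noncomputable def upCells (Z : ℝ → ℝ) (m : ℝ → ℝ → M) (A : Set M) (n : ℕ) : Finset ℕ :=
  {k ∈ Finset.range (2 ^ n) | UpStep Z m A ((1 / 2) ^ n) (k * (1 / 2) ^ n)}

/-- The zeros of `Z` in `[0, 1]` at which the derivative `Z'` is positive and the mark `m₀` lies
in `A`: the objects counted by the Rice formula. -/
def markedUpcrossings (Z Z' : ℝ → ℝ) (m₀ : ℝ → M) (A : Set M) : Set ℝ :=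
  {t | t ∈ Icc (0 : ℝ) 1 ∧ Z t = 0 ∧ 0 < Z' t ∧ m₀ t ∈ A}

theorem mem_upCells {n k : ℕ} :
    k ∈ upCells Z m A n ↔ k < 2 ^ n ∧ UpStep Z m A ((1 / 2) ^ n) (k * (1 / 2) ^ n) := by
  simp only [upCells, Finset.mem_filter, Finset.mem_range]

theorem upCells_mono {B : Set M} (hAB : A ⊆ B) (n : ℕ) : upCells Z m A n ⊆ upCells Z m B n := by
  intro k hk
  rw [mem_upCells] at hk ⊢
  exact ⟨hk.1, hk.2.1, hk.2.2.1, hAB hk.2.2.2⟩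

theorem UpStep.left_or_right {h s : ℝ} (hs : UpStep Z m univ (2 * h) s) :
    UpStep Z m univ h s ∨ UpStep Z m univ h (s + h) := by
  obtain ⟨hneg, hpos, -⟩ := hs
  rcases le_or_gt (Z (s + h)) 0 with hmid | hmid
  · exact Or.inr ⟨hmid, by rwa [add_assoc, ← two_mul], mem_univ _⟩
  · exact Or.inl ⟨hneg, hmid, mem_univ _⟩

theorem exists_mem_upCells_succ {n k : ℕ} (hk : k ∈ upCells Z m univ n) :
    ∃ j ∈ upCells Z m univ (n + 1), j / 2 = k := by
  obtain ⟨hlt, hstep⟩ := mem_upCells.1 hk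
  have hmesh : ((1 : ℝ) / 2) ^ n = 2 * (1 / 2) ^ (n + 1) := by ring
  rw [hmesh] at hstep
  rcases hstep.left_or_right with hleft | hright
  · refine ⟨2 * k, mem_upCells.2 ⟨by omega, ?_⟩, by omega⟩
    convert hleft using 1
    push_cast
    ring
  · refine ⟨2 * k + 1, mem_upCells.2 ⟨by omega, ?_⟩, by omega⟩
    convert hright using 1
    push_cast
    ring

theorem monotone_card_upCells : Monotone fun n => (upCells Z m univ n).card := by
  refine monotone_nat_of_le_succ fun n => ?_
  have hsub : upCells Z m univ n ⊆ (upCells Z m univ (n + 1)).image (· / 2) := fun k hk =>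
    Finset.mem_image.2 (exists_mem_upCells_succ hk)
  exact (Finset.card_le_card hsub).trans Finset.card_image_le

theorem tendsto_half_pow : Tendsto (fun n : ℕ => ((1 : ℝ) / 2) ^ n) atTop (𝓝[>] 0) :=
  tendsto_pow_atTop_nhdsWithin_zero_of_lt_one (by norm_num) (by norm_num)

theorem floor_mul_two_pow_le {t : ℝ} (ht : 0 ≤ t) (n : ℕ) :
    (⌊t * 2 ^ n⌋₊ : ℝ) * (1 / 2) ^ n ≤ t := by
  rw [one_div, inv_pow, ← div_eq_mul_inv, div_le_iff₀ (by positivity)]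
  exact Nat.floor_le (by positivity)

theorem lt_floor_mul_two_pow_add (t : ℝ) (n : ℕ) :
    t < (⌊t * 2 ^ n⌋₊ : ℝ) * (1 / 2) ^ n + (1 / 2) ^ n := by
  rw [← add_one_mul, one_div, inv_pow, ← div_eq_mul_inv, lt_div_iff₀ (by positivity)]
  exact Nat.lt_floor_add_one _

theorem tendsto_floor_mul_two_pow {t : ℝ} (ht : 0 ≤ t) :
    Tendsto (fun n : ℕ => (⌊t * 2 ^ n⌋₊ : ℝ) * (1 / 2) ^ n) atTop (𝓝 t) := by
  have hpow : Tendsto (fun n : ℕ => (2 : ℝ) ^ n) atTop atTop :=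
    tendsto_pow_atTop_atTop_of_one_lt one_lt_two
  simpa only [Function.comp_def, one_div_pow, mul_one_div] using
    (tendsto_nat_floor_mul_div_atTop ht).comp hpow

theorem eventually_injOn_floor_mul_two_pow (F : Finset ℝ) (hF : ∀ t ∈ F, 0 ≤ t) :
    ∀ᶠ n : ℕ in atTop, InjOn (fun t : ℝ => ⌊t * 2 ^ n⌋₊) F := by
  have hsep : ∀ᶠ n : ℕ in atTop, ∀ a ∈ F, ∀ b ∈ F, a ≠ b → ((1 : ℝ) / 2) ^ n < |a - b| := by
    refine (Finset.eventually_all F).2 fun a _ => (Finset.eventually_all F).2 fun b _ => ?_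
    rw [eventually_imp_distrib_left]
    exact fun hab => (tendsto_half_pow.mono_right nhdsWithin_le_nhds).eventually_lt_const
      (abs_pos.2 (sub_ne_zero.2 hab))
  filter_upwards [hsep] with n hn a ha b hb hab
  by_contra hne
  have ha' := floor_mul_two_pow_le (hF a ha) n
  have hb' := floor_mul_two_pow_le (hF b hb) n
  have ha'' := lt_floor_mul_two_pow_add a n
  have hb'' := lt_floor_mul_two_pow_add b n
  simp only at hab
  rw [hab] at ha' ha''
  exact (hn a ha b hb hne).not_ge (abs_le.2 ⟨by linarith, by linarith⟩)

theorem eventually_lt_of_hasStrictDerivAt {d t : ℝ} (hZ : HasStrictDerivAt Z d t) (hd : 0 < d) :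
    ∀ᶠ p : ℝ × ℝ in 𝓝 (t, t), p.1 < p.2 → Z p.1 < Z p.2 := by
  filter_upwards [hZ.isLittleO.def (half_pos hd)] with p hp hlt
  have hnorm : ‖p.1 - p.2‖ = p.2 - p.1 := by
    rw [Real.norm_eq_abs, abs_of_neg (sub_neg.2 hlt), neg_sub]
  rw [hnorm, Real.norm_eq_abs] at hp
  have hupper := (abs_le.1 hp).2
  simp only [ContinuousLinearMap.toSpanSingleton_apply, smul_eq_mul] at hupper
  nlinarith [mul_pos hd (sub_pos.2 hlt)]

theorem exists_mem_nhds_strictMonoOn {d t : ℝ} (hZ : HasStrictDerivAt Z d t) (hd : 0 < d) :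
    ∃ J ∈ 𝓝 t, J.OrdConnected ∧ StrictMonoOn Z J := by
  obtain ⟨ε, hε, hball⟩ :=
    Metric.eventually_nhds_iff_ball.1 (eventually_lt_of_hasStrictDerivAt hZ hd)
  refine ⟨Metric.ball t ε, Metric.ball_mem_nhds t hε, ?_, fun x hx y hy hxy => ?_⟩
  · rw [Real.ball_eq_Ioo]
    exact ordConnected_Ioo
  · exact hball (x, y) (by rw [← ball_prod_same]; exact ⟨hx, hy⟩) hxy

theorem UpStep.not_of_monotoneOn {J : Set ℝ} {h s s' : ℝ} (hs : UpStep Z m A h s)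
    (hJ : J.OrdConnected) (hZ : MonotoneOn Z J) (hsJ : s ∈ J) (hs'J : s' ∈ J) (hh : 0 ≤ h)
    (hle : s + h ≤ s') : ¬ UpStep Z m A h s' := by
  intro hs'
  have hmid : s + h ∈ J := hJ.out hsJ hs'J ⟨le_add_of_nonneg_right hh, hle⟩
  exact (hs.2.1.trans_le (hZ hmid hs'J hle)).not_ge hs'.1

theorem upCells_eq_of_monotoneOn {J : Set ℝ} {n a b : ℕ} (hJ : J.OrdConnected)
    (hZ : MonotoneOn Z J) (ha : a ∈ upCells Z m A n) (hb : b ∈ upCells Z m A n)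
    (haJ : a * (1 / 2 : ℝ) ^ n ∈ J) (hbJ : b * (1 / 2 : ℝ) ^ n ∈ J) : a = b := by
  wlog hab : a < b generalizing a b
  · rcases (not_lt.1 hab).eq_or_lt with heq | hlt
    · exact heq.symm
    · exact (this hb ha hbJ haJ hlt).symm
  have hh : (0 : ℝ) ≤ (1 / 2) ^ n := by positivity
  have hle : (a : ℝ) * (1 / 2) ^ n + (1 / 2) ^ n ≤ b * (1 / 2) ^ n := by
    rw [← add_one_mul]
    gcongr
    exact_mod_cast hab
  exact absurd (mem_upCells.1 hb).2
    ((mem_upCells.1 ha).2.not_of_monotoneOn hJ hZ haJ hbJ hh hle)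

variable [TopologicalSpace M]

theorem eventually_not_upStep {K : Set M} (hK : IsClosed K) (hZ : Continuous Z) {y : ℝ}
    (hm : Tendsto (fun p : ℝ × ℝ => m p.1 p.2) (𝓝[>] 0 ×ˢ 𝓝 y) (𝓝 (m₀ y)))
    (hy : Z y = 0 → m₀ y ∉ K) : ∀ᶠ p : ℝ × ℝ in 𝓝[>] 0 ×ˢ 𝓝 y, ¬ UpStep Z m K p.1 p.2 := by
  have hfst : Tendsto Prod.fst (𝓝[>] (0 : ℝ) ×ˢ 𝓝 y) (𝓝 0) :=
    tendsto_fst.mono_right nhdsWithin_le_nhds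
  have hsnd : Tendsto Prod.snd (𝓝[>] (0 : ℝ) ×ˢ 𝓝 y) (𝓝 y) := tendsto_snd
  have hleft : Tendsto (fun p : ℝ × ℝ => Z p.2) (𝓝[>] 0 ×ˢ 𝓝 y) (𝓝 (Z y)) :=
    (hZ.tendsto y).comp hsnd
  have hright : Tendsto (fun p : ℝ × ℝ => Z (p.2 + p.1)) (𝓝[>] 0 ×ˢ 𝓝 y) (𝓝 (Z y)) :=
    (hZ.tendsto y).comp (by simpa only [add_zero] using hsnd.add hfst)
  rcases lt_trichotomy (Z y) 0 with hneg | hzero | hpos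
  · filter_upwards [hright.eventually_lt_const hneg] with p hp hstep
    exact hp.not_gt hstep.2.1
  · filter_upwards [hm.eventually (hK.isOpen_compl.mem_nhds (hy hzero))] with p hp hstep
    exact hp hstep.2.2
  · filter_upwards [hleft.eventually_const_lt hpos] with p hp hstep
    exact hp.not_ge hstep.1

theorem eventually_forall_upStep_exists_mem {K : Set M} (hK : IsClosed K) (hZ : Continuous Z)
    (hm : ∀ s, Tendsto (fun p : ℝ × ℝ => m p.1 p.2) (𝓝[>] 0 ×ˢ 𝓝 s) (𝓝 (m₀ s)))
    (hpos : ∀ s, m₀ s ∈ K → 0 < Z' s) {J : ℝ → Set ℝ} (hJ : ∀ t, J t ∈ 𝓝 t) :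
    ∀ᶠ h in 𝓝[>] (0 : ℝ), ∀ s ∈ Icc (0 : ℝ) 1, UpStep Z m K h s →
      ∃ t ∈ markedUpcrossings Z Z' m₀ K, s ∈ J t := by
  have hloc : ∀ y ∈ Icc (0 : ℝ) 1, ∀ᶠ p : ℝ × ℝ in 𝓝[>] 0 ×ˢ 𝓝 y, UpStep Z m K p.1 p.2 →
      ∃ t ∈ markedUpcrossings Z Z' m₀ K, p.2 ∈ J t := by
    intro y hy
    by_cases hyK : Z y = 0 ∧ m₀ y ∈ K
    · filter_upwards [tendsto_snd.eventually (hJ y)] with p hp _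
      exact ⟨y, ⟨hy, hyK.1, hpos y hyK.2, hyK.2⟩, hp⟩
    · filter_upwards [eventually_not_upStep hK hZ (hm y) (not_and.1 hyK)] with p hp hstep
      exact absurd hstep hp
  have hset := isCompact_Icc.mem_prod_nhdsSet_of_forall hloc
  exact (Eventually.curry hset).mono fun h hh => hh.self_of_nhdsSet

/-- Each up-step with mark in `K` lies near a marked upcrossing by compactness, and no two up-steps
lie near the same one because `Z` is strictly increasing there. -/
theorem eventually_card_upCells_le_encard {K : Set M} (hK : IsClosed K)
    (hZ : ∀ s, HasStrictDerivAt Z (Z' s) s)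
    (hm : ∀ s, Tendsto (fun p : ℝ × ℝ => m p.1 p.2) (𝓝[>] 0 ×ˢ 𝓝 s) (𝓝 (m₀ s)))
    (hpos : ∀ s, m₀ s ∈ K → 0 < Z' s) :
    ∀ᶠ n in atTop, ((upCells Z m K n).card : ℕ∞) ≤ (markedUpcrossings Z Z' m₀ K).encard := by
  have hcont : Continuous Z := continuous_iff_continuousAt.2 fun s => (hZ s).hasDerivAt.continuousAt
  have hJ : ∀ t, ∃ J ∈ 𝓝 t, 0 < Z' t → J.OrdConnected ∧ StrictMonoOn Z J := by
    intro t
    by_cases ht : 0 < Z' t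
    · obtain ⟨J, hJt, hJ⟩ := exists_mem_nhds_strictMonoOn (hZ t) ht
      exact ⟨J, hJt, fun _ => hJ⟩
    · exact ⟨univ, univ_mem, fun h => absurd h ht⟩
  choose J hJmem hJmono using hJ
  filter_upwards [tendsto_half_pow.eventually
    (eventually_forall_upStep_exists_mem hK hcont hm hpos hJmem)] with n hn
  have hnear : ∀ k ∈ upCells Z m K n,
      ∃ t ∈ markedUpcrossings Z Z' m₀ K, (k : ℝ) * (1 / 2) ^ n ∈ J t := by
    intro k hk
    obtain ⟨hlt, hstep⟩ := mem_upCells.1 hk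
    refine hn _ ⟨by positivity, ?_⟩ hstep
    rw [one_div, inv_pow, ← div_eq_mul_inv, div_le_one (by positivity)]
    exact_mod_cast hlt.le
  choose! τ hτ hτJ using hnear
  have hinj : InjOn τ (upCells Z m K n) := by
    intro a ha b hb hab
    obtain ⟨hord, hmono⟩ := hJmono (τ a) (hτ a ha).2.2.1
    exact upCells_eq_of_monotoneOn hord hmono.monotoneOn ha hb (hτJ a ha) (hab ▸ hτJ b hb)
  rw [← encard_coe_eq_coe_finsetCard]
  exact encard_le_encard_of_injOn hτ hinj

theorem eventually_floor_mem_upCells {U : Set M} (hU : IsOpen U) {t d : ℝ} (ht : t ∈ Ico (0 : ℝ) 1)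
    (hZt : Z t = 0) (hZ : HasStrictDerivAt Z d t) (hd : 0 < d)
    (hm : Tendsto (fun p : ℝ × ℝ => m p.1 p.2) (𝓝[>] 0 ×ˢ 𝓝 t) (𝓝 (m₀ t))) (htU : m₀ t ∈ U) :
    ∀ᶠ n : ℕ in atTop, ⌊t * 2 ^ n⌋₊ ∈ upCells Z m U n := by
  have hleft := tendsto_floor_mul_two_pow ht.1
  have hright : Tendsto (fun n : ℕ => (⌊t * 2 ^ n⌋₊ : ℝ) * (1 / 2) ^ n + (1 / 2) ^ n) atTop
      (𝓝 t) := by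
    simpa only [add_zero] using hleft.add (tendsto_half_pow.mono_right nhdsWithin_le_nhds)
  have hincr := eventually_lt_of_hasStrictDerivAt hZ hd
  filter_upwards [(hleft.prodMk_nhds tendsto_const_nhds).eventually hincr,
    (tendsto_const_nhds.prodMk_nhds hright).eventually hincr,
    (hm.comp (tendsto_half_pow.prodMk hleft)).eventually (hU.mem_nhds htU)] with n hn₁ hn₂ hmark
  refine mem_upCells.2 ⟨?_, ?_, ?_, hmark⟩
  · rw [Nat.floor_lt (mul_nonneg ht.1 (by positivity)), Nat.cast_pow, Nat.cast_ofNat]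
    exact mul_lt_of_lt_one_left (by positivity) ht.2
  · rcases (floor_mul_two_pow_le ht.1 n).lt_or_eq with hlt | heq
    · exact (hZt ▸ hn₁ hlt).le
    · rw [heq, hZt]
  · exact hZt ▸ hn₂ (lt_floor_mul_two_pow_add t n)

theorem encard_markedUpcrossings_le_liminf {U : Set M} (hU : IsOpen U)
    (hZ : ∀ s, HasStrictDerivAt Z (Z' s) s)
    (hm : ∀ s, Tendsto (fun p : ℝ × ℝ => m p.1 p.2) (𝓝[>] 0 ×ˢ 𝓝 s) (𝓝 (m₀ s)))
    (hone : Z 1 ≠ 0) :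
    ((markedUpcrossings Z Z' m₀ U).encard : ℝ≥0∞) ≤
      liminf (fun n => ((upCells Z m U n).card : ℝ≥0∞)) atTop := by
  have hfin : ∀ F : Finset ℝ, (F : Set ℝ) ⊆ markedUpcrossings Z Z' m₀ U →
      (F.card : ℝ≥0∞) ≤ liminf (fun n => ((upCells Z m U n).card : ℝ≥0∞)) atTop := by
    intro F hF
    have hmem : ∀ᶠ n : ℕ in atTop, ∀ t ∈ F, ⌊t * 2 ^ n⌋₊ ∈ upCells Z m U n := by
      refine (Finset.eventually_all F).2 fun t ht => ?_
      obtain ⟨htI, hZt, hd, htU⟩ := hF ht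
      have ht1 : t < 1 := htI.2.lt_of_ne fun h => hone (h ▸ hZt)
      exact eventually_floor_mem_upCells hU ⟨htI.1, ht1⟩ hZt (hZ t) hd (hm t) htU
    refine le_liminf_of_le (by isBoundedDefault) ?_
    filter_upwards [hmem, eventually_injOn_floor_mul_two_pow F fun t ht => (hF ht).1.1] with
      n hmem hinj
    exact_mod_cast Finset.card_le_card_of_injOn _ hmem hinj
  rcases (markedUpcrossings Z Z' m₀ U).finite_or_infinite with hfinite | hinfinite
  · rw [hfinite.encard_eq_coe_toFinset_card]
    exact hfin hfinite.toFinset hfinite.coe_toFinset.subset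
  · rw [hinfinite.encard_eq, ENat.toENNReal_top]
    refine le_of_tendsto' ENNReal.tendsto_nat_nhds_top fun N => ?_
    obtain ⟨F, hF, rfl⟩ := hinfinite.exists_subset_card_eq N
    exact hfin F hF

end Counting

section DifferenceQuotients

theorem tendsto_inv_smul_sub_of_hasStrictFDerivAt {α E G : Type*} [NormedAddCommGroup E]
    [NormedSpace ℝ E] [NormedAddCommGroup G] [NormedSpace ℝ G] {F : E → G} {F' : E →L[ℝ] G} {x : E}
    (hF : HasStrictFDerivAt F F' x) {l : Filter α} {p : α → E} {h : α → ℝ}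
    (hp : Tendsto p l (𝓝 x)) (hh : Tendsto h l (𝓝[≠] 0)) (u : E) :
    Tendsto (fun a => (h a)⁻¹ • (F (p a + h a • u) - F (p a))) l (𝓝 (F' u)) := by
  have hne : ∀ᶠ a in l, h a ≠ 0 := hh.eventually self_mem_nhdsWithin
  have hh0 : Tendsto h l (𝓝 0) := hh.mono_right nhdsWithin_le_nhds
  have hpair : Tendsto (fun a => (p a + h a • u, p a)) l (𝓝 (x, x)) := by
    refine Tendsto.prodMk_nhds ?_ hp
    simpa only [zero_smul, add_zero] using hp.add (hh0.smul_const u)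
  have herror : (fun a => F (p a + h a • u) - F (p a) - h a • F' u) =o[l] h := by
    refine ((hF.isLittleO.comp_tendsto hpair).congr_left fun a => ?_).trans_isBigO ?_
    · simp only [Function.comp_apply, add_sub_cancel_left, map_smul]
    · refine Asymptotics.IsBigO.of_bound ‖u‖ (Eventually.of_forall fun a => ?_)
      simp only [Function.comp_apply, add_sub_cancel_left, norm_smul, mul_comm ‖u‖, le_refl]
  have hquot := herror.tendsto_inv_smul_nhds_zero.add_const (F' u)
  rw [zero_add] at hquot
  refine hquot.congr' ?_
  filter_upwards [hne] with a ha
  rw [smul_sub, inv_smul_smul₀ ha, sub_add_cancel]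

/-- The mark attached to a step of length `h` from time `s`: the difference quotient of the field in
space, and an approximation of its time derivative. The latter is the difference quotient along the
course `t ↦ (v t, t)` of the ship minus `v` times the former, so that
`F (v (s + h), s + h) = F (v s, s) + h (v a + b)` holds exactly for the mark `(a, b)`. -/
noncomputable def diffMark (F : ℝ × ℝ → ℝ) (v h s : ℝ) : ℝ × ℝ :=
  ((F (v * s + h, s) - F (v * s, s)) / h,
    (F (v * (s + h), s + h) - F (v * s, s)) / h - v * ((F (v * s + h, s) - F (v * s, s)) / h))

variable {F : ℝ × ℝ → ℝ}

theorem deriv_fst_eq_fderiv {p : ℝ × ℝ} (hF : DifferentiableAt ℝ F p) :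
    deriv (fun y => F (y, p.2)) p.1 = fderiv ℝ F p (1, 0) :=
  (hF.hasFDerivAt.comp_hasDerivAt_of_eq p.1
    ((hasDerivAt_id p.1).prodMk (hasDerivAt_const p.1 p.2)) rfl).deriv

theorem deriv_snd_eq_fderiv {p : ℝ × ℝ} (hF : DifferentiableAt ℝ F p) :
    deriv (fun s => F (p.1, s)) p.2 = fderiv ℝ F p (0, 1) :=
  (hF.hasFDerivAt.comp_hasDerivAt_of_eq p.2
    ((hasDerivAt_const p.2 p.1).prodMk (hasDerivAt_id p.2)) rfl).deriv

theorem fderiv_course_direction {p : ℝ × ℝ} (hF : DifferentiableAt ℝ F p) (v : ℝ) :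
    fderiv ℝ F p (v, 1) =
      v * deriv (fun y => F (y, p.2)) p.1 + deriv (fun s => F (p.1, s)) p.2 := by
  rw [deriv_fst_eq_fderiv hF, deriv_snd_eq_fderiv hF, ← smul_eq_mul, ← map_smul, ← map_add]
  simp only [Prod.smul_mk, smul_eq_mul, mul_one, mul_zero, Prod.mk_add_mk, add_zero, zero_add]

theorem hasStrictDerivAt_course (hF : ContDiff ℝ 1 F) (v t : ℝ) :
    HasStrictDerivAt (fun s => F (v * s, s))
      (v * deriv (fun y => F (y, t)) (v * t) + deriv (fun s => F (v * t, s)) t) t := by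
  have hcourse : HasStrictDerivAt (fun s : ℝ => (v * s, s)) (v, 1) t := by
    simpa only [id_eq, mul_one] using
      ((hasStrictDerivAt_id t).const_mul v).prodMk (hasStrictDerivAt_id t)
  rw [← fderiv_course_direction (p := (v * t, t)) (hF.differentiable one_ne_zero _)]
  exact (hF.contDiffAt.hasStrictFDerivAt one_ne_zero).comp_hasStrictDerivAt_of_eq t hcourse rfl

theorem tendsto_diffMark (hF : ContDiff ℝ 1 F) (v t : ℝ) :
    Tendsto (fun p : ℝ × ℝ => diffMark F v p.1 p.2) (𝓝[>] 0 ×ˢ 𝓝 t)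
      (𝓝 (deriv (fun y => F (y, t)) (v * t), deriv (fun s => F (v * t, s)) t)) := by
  have hdiff : DifferentiableAt ℝ F (v * t, t) := hF.differentiable one_ne_zero _
  have hstrict : HasStrictFDerivAt F (fderiv ℝ F (v * t, t)) (v * t, t) :=
    hF.contDiffAt.hasStrictFDerivAt one_ne_zero
  have hbase : Tendsto (fun p : ℝ × ℝ => (v * p.2, p.2)) (𝓝[>] 0 ×ˢ 𝓝 t) (𝓝 (v * t, t)) :=
    (tendsto_snd.const_mul v).prodMk_nhds tendsto_snd
  have hstep : Tendsto Prod.fst (𝓝[>] (0 : ℝ) ×ˢ 𝓝 t) (𝓝[≠] 0) :=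
    tendsto_fst.mono_right (nhdsWithin_mono 0 fun _ hx => ne_of_gt hx)
  have hspace := tendsto_inv_smul_sub_of_hasStrictFDerivAt hstrict hbase hstep (1, 0)
  have hcourse := tendsto_inv_smul_sub_of_hasStrictFDerivAt hstrict hbase hstep (v, 1)
  rw [← deriv_fst_eq_fderiv hdiff] at hspace
  rw [fderiv_course_direction hdiff] at hcourse
  have hmark := hspace.prodMk_nhds (hcourse.sub (hspace.const_mul v))
  rw [add_sub_cancel_left] at hmark
  refine hmark.congr fun p => ?_
  simp only [diffMark, Prod.smul_mk, Prod.mk_add_mk, smul_eq_mul, mul_one, mul_zero, add_zero,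
    mul_add, mul_comm v p.1, inv_mul_eq_div]

end DifferenceQuotients

section AlmostSureLimits

variable {Ω : Type*} [MeasurableSpace Ω] {P : Measure Ω}

theorem tendsto_charFun_map [IsFiniteMeasure P] {E : Type*} [NormedAddCommGroup E]
    [InnerProductSpace ℝ E] [MeasurableSpace E] [BorelSpace E] [SecondCountableTopology E]
    {X : ℕ → Ω → E} {Y : Ω → E} (hX : ∀ n, AEMeasurable (X n) P) (hY : AEMeasurable Y P)
    (hlim : ∀ᵐ ω ∂P, Tendsto (fun n => X n ω) atTop (𝓝 (Y ω))) (t : E) :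
    Tendsto (fun n => charFun (P.map (X n)) t) atTop (𝓝 (charFun (P.map Y) t)) := by
  have hcont : Continuous fun x : E => Complex.exp (inner ℝ x t * Complex.I) := by fun_prop
  have hmap : ∀ Z : Ω → E, AEMeasurable Z P →
      charFun (P.map Z) t = ∫ ω, Complex.exp (inner ℝ (Z ω) t * Complex.I) ∂P := fun Z hZ => by
    rw [charFun_apply, integral_map hZ hcont.aestronglyMeasurable]
  simp_rw [hmap Y hY, hmap _ (hX _)]
  refine tendsto_integral_of_dominated_convergence (fun _ => 1)
    (fun n => (hcont.measurable.comp_aemeasurable (hX n)).aestronglyMeasurable)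
    (integrable_const 1) (fun n => Eventually.of_forall fun ω => ?_) ?_
  · rw [Complex.norm_exp_ofReal_mul_I]
  · filter_upwards [hlim] with ω hω using (hcont.tendsto _).comp hω

theorem exists_charFun_ne_zero (μ : Measure ℝ) [IsProbabilityMeasure μ] :
    ∃ t ≠ 0, charFun μ t ≠ 0 := by
  have hzero : charFun μ 0 ≠ 0 := by
    simp only [charFun_zero, probReal_univ, Complex.ofReal_one, ne_eq, one_ne_zero,
      not_false_eq_true]
  have hnear : ∀ᶠ t in 𝓝[≠] (0 : ℝ), charFun μ t ≠ 0 :=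
    nhdsWithin_le_nhds (continuous_charFun.continuousAt.eventually_ne hzero)
  obtain ⟨t, htnear, ht0⟩ := (hnear.and self_mem_nhdsWithin).exists
  exact ⟨t, ht0, htnear⟩

theorem charFun_map_of_integral_eq_zero {X : Ω → ℝ} (hX : HasGaussianLaw X P)
    (hX0 : ∫ ω, X ω ∂P = 0) (t : ℝ) :
    charFun (P.map X) t = Complex.exp (-(Var[X; P] * t ^ 2 / 2 : ℝ)) := by
  rw [hX.map_eq_gaussianReal, hX0, charFun_gaussianReal,
    Real.coe_toNNReal _ (variance_nonneg _ _)]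
  push_cast
  ring_nf

section Real

variable {X : ℕ → Ω → ℝ} {Y : Ω → ℝ}

/-- The variance is read off from the modulus of the characteristic function at a point where the
limit does not vanish. -/
theorem exists_tendsto_variance_of_tendsto_ae (hX : ∀ n, HasGaussianLaw (X n) P)
    (hX0 : ∀ n, ∫ ω, X n ω ∂P = 0)
    (hlim : ∀ᵐ ω ∂P, Tendsto (fun n => X n ω) atTop (𝓝 (Y ω))) :
    ∃ σ, Tendsto (fun n => Var[X n; P]) atTop (𝓝 σ) := by
  have hP : IsProbabilityMeasure P := (hX 0).isProbabilityMeasure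
  have hmeas : ∀ n, AEMeasurable (X n) P := fun n => (hX n).aemeasurable
  have hY : AEMeasurable Y P := aemeasurable_of_tendsto_metrizable_ae atTop hmeas hlim
  have hPY : IsProbabilityMeasure (P.map Y) := Measure.isProbabilityMeasure_map hY
  obtain ⟨t, ht0, ht⟩ := exists_charFun_ne_zero (P.map Y)
  refine ⟨-(2 * Real.log ‖charFun (P.map Y) t‖) / t ^ 2, ?_⟩
  have hlog := (Real.continuousAt_log (norm_ne_zero_iff.2 ht)).tendsto.comp
    (tendsto_charFun_map hmeas hY hlim t).norm
  refine ((hlog.const_mul 2).neg.div_const (t ^ 2)).congr fun n => ?_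
  rw [Function.comp_apply, charFun_map_of_integral_eq_zero (hX n) (hX0 n), ← Complex.ofReal_neg,
    Complex.norm_exp_ofReal, Real.log_exp]
  field_simp

theorem map_eq_gaussianReal_of_tendsto_ae (hX : ∀ n, HasGaussianLaw (X n) P)
    (hX0 : ∀ n, ∫ ω, X n ω ∂P = 0)
    (hlim : ∀ᵐ ω ∂P, Tendsto (fun n => X n ω) atTop (𝓝 (Y ω))) {σ : ℝ}
    (hσ : Tendsto (fun n => Var[X n; P]) atTop (𝓝 σ)) :
    P.map Y = gaussianReal 0 σ.toNNReal := by
  have hP : IsProbabilityMeasure P := (hX 0).isProbabilityMeasure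
  have hmeas : ∀ n, AEMeasurable (X n) P := fun n => (hX n).aemeasurable
  have hY : AEMeasurable Y P := aemeasurable_of_tendsto_metrizable_ae atTop hmeas hlim
  refine Measure.ext_of_charFun (funext fun s => ?_)
  refine tendsto_nhds_unique (tendsto_charFun_map hmeas hY hlim s) ?_
  have hcont : Continuous fun x : ℝ => Complex.exp (-(x * s ^ 2 / 2 : ℝ)) := by fun_prop
  rw [charFun_gaussianReal,
    Real.coe_toNNReal _ (ge_of_tendsto' hσ fun n => variance_nonneg _ _)]
  simp_rw [charFun_map_of_integral_eq_zero (hX _) (hX0 _)]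
  convert! (hcont.tendsto σ).comp hσ using 2
  push_cast
  ring_nf

theorem hasGaussianLaw_of_tendsto_ae (hX : ∀ n, HasGaussianLaw (X n) P)
    (hX0 : ∀ n, ∫ ω, X n ω ∂P = 0)
    (hlim : ∀ᵐ ω ∂P, Tendsto (fun n => X n ω) atTop (𝓝 (Y ω))) :
    HasGaussianLaw Y P ∧ ∫ ω, Y ω ∂P = 0 ∧
      Tendsto (fun n => Var[X n; P]) atTop (𝓝 Var[Y; P]) := by
  obtain ⟨σ, hσ⟩ := exists_tendsto_variance_of_tendsto_ae hX hX0 hlim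
  have hlaw : HasLaw Y (gaussianReal 0 σ.toNNReal) P :=
    ⟨aemeasurable_of_tendsto_metrizable_ae atTop (fun n => (hX n).aemeasurable) hlim,
      map_eq_gaussianReal_of_tendsto_ae hX hX0 hlim hσ⟩
  refine ⟨hlaw.hasGaussianLaw, ?_, ?_⟩
  · rw [hlaw.integral_eq, integral_id_gaussianReal]
  · rwa [hlaw.variance_eq, variance_id_gaussianReal,
      Real.coe_toNNReal _ (ge_of_tendsto' hσ fun n => variance_nonneg _ _)]

end Real

section Vectors

variable {ι : Type*} [Finite ι] {X : ℕ → ι → Ω → ℝ} {Y : ι → Ω → ℝ}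

theorem covariance_eq_variance_add_sub {U V : Ω → ℝ} [IsFiniteMeasure P] (hU : MemLp U 2 P)
    (hV : MemLp V 2 P) : cov[U, V; P] = (Var[U + V; P] - Var[U; P] - Var[V; P]) / 2 := by
  rw [variance_add hU hV]
  ring

theorem tendsto_covariance_of_tendsto_ae (hX : ∀ n, HasGaussianLaw (fun ω i => X n i ω) P)
    (hX0 : ∀ n i, ∫ ω, X n i ω ∂P = 0)
    (hlim : ∀ i, ∀ᵐ ω ∂P, Tendsto (fun n => X n i ω) atTop (𝓝 (Y i ω))) (i j : ι) :
    Tendsto (fun n => cov[X n i, X n j; P]) atTop (𝓝 cov[Y i, Y j; P]) := by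
  have hP : IsProbabilityMeasure P := (hX 0).isProbabilityMeasure
  have hXi : ∀ n i, HasGaussianLaw (X n i) P := fun n i => (hX n).eval i
  have hYi := fun i =>
    hasGaussianLaw_of_tendsto_ae (fun n => hXi n i) (fun n => hX0 n i) (hlim i)
  have hsum_mean : ∀ n, ∫ ω, (X n i + X n j) ω ∂P = 0 := fun n => by
    rw [integral_add' (hXi n i).integrable (hXi n j).integrable, hX0, hX0, add_zero]
  have hsum_lim : ∀ᵐ ω ∂P, Tendsto (fun n => (X n i + X n j) ω) atTop (𝓝 ((Y i + Y j) ω)) := by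
    filter_upwards [hlim i, hlim j] with ω hi hj using hi.add hj
  have hsum := hasGaussianLaw_of_tendsto_ae (fun n => ((hX n).prodMk i j).add) hsum_mean hsum_lim
  rw [covariance_eq_variance_add_sub (hYi i).1.memLp_two (hYi j).1.memLp_two]
  simp_rw [covariance_eq_variance_add_sub (hXi _ i).memLp_two (hXi _ j).memLp_two]
  exact ((hsum.2.2.sub (hYi i).2.2).sub (hYi j).2.2).div_const 2

end Vectors

end AlmostSureLimits

section NormalDensity

open Matrix

theorem lintegral_fin_prod_eq_prod {n : ℕ} {E : Fin n → Type*} [∀ i, MeasurableSpace (E i)]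
    {μ : ∀ i, Measure (E i)} [∀ i, SigmaFinite (μ i)] {f : ∀ i, E i → ℝ≥0∞}
    (hf : ∀ i, Measurable (f i)) :
    ∫⁻ x, ∏ i, f i (x i) ∂(Measure.pi μ) = ∏ i, ∫⁻ x, f i x ∂(μ i) := by
  induction n with
  | zero =>
    simp only [Finset.univ_eq_empty, Finset.prod_empty, lintegral_one, Measure.pi_empty_univ]
  | succ n ih =>
    have htail : Measurable fun x : ∀ i : Fin n, E i.succ => ∏ i : Fin n, f i.succ (x i) :=
      Finset.measurable_prod _ fun i _ => (hf i.succ).comp (measurable_pi_apply i)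
    calc ∫⁻ x, ∏ i, f i (x i) ∂(Measure.pi μ)
        = ∫⁻ x : E 0 × (∀ i : Fin n, E i.succ), f 0 x.1 * ∏ i : Fin n, f i.succ (x.2 i)
            ∂((μ 0).prod (Measure.pi fun i => μ i.succ)) := by
          rw [← ((measurePreserving_piFinSuccAbove μ 0).symm).lintegral_comp
            (f := fun x : ∀ i, E i => ∏ i, f i (x i))
            (Finset.measurable_prod _ fun i _ => (hf i).comp (measurable_pi_apply i))]
          simp_rw [MeasurableEquiv.piFinSuccAbove_symm_apply, Fin.insertNthEquiv,
            Fin.prod_univ_succ, Fin.insertNth_zero, Equiv.coe_fn_mk, Fin.cons_succ, Fin.cons_zero]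
          rfl
      _ = (∫⁻ x, f 0 x ∂(μ 0)) * ∏ i : Fin n, ∫⁻ x, f i.succ x ∂(μ i.succ) := by
          rw [← ih fun i => hf i.succ, ← lintegral_prod_mul (hf 0).aemeasurable htail.aemeasurable]
      _ = ∏ i, ∫⁻ x, f i x ∂(μ i) := by rw [Fin.prod_univ_succ]

theorem pi_withDensity {n : ℕ} {E : Fin n → Type*} [∀ i, MeasureSpace (E i)]
    [∀ i, SigmaFinite (volume : Measure (E i))] {f : ∀ i, E i → ℝ≥0∞}
    (hf : ∀ i, Measurable (f i)) [∀ i, SigmaFinite (volume.withDensity (f i))] :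
    Measure.pi (fun i => volume.withDensity (f i)) =
      (volume : Measure (∀ i, E i)).withDensity fun x => ∏ i, f i (x i) := by
  refine Measure.pi_eq fun s hs => ?_
  rw [withDensity_apply _ (MeasurableSet.univ_pi hs), volume_pi, Measure.restrict_pi_pi,
    lintegral_fin_prod_eq_prod hf]
  exact Finset.prod_congr rfl fun i _ => (withDensity_apply _ (hs i)).symm

variable {n : ℕ}

theorem prod_gaussianPDF_eq_normalDensity (x : Fin n → ℝ) :
    ∏ i, gaussianPDF 0 1 (x i) = ENNReal.ofReal (normalDensity 0 1 x) := by
  have hsqrt : Real.sqrt ((2 * Real.pi) ^ n) = Real.sqrt (2 * Real.pi) ^ n :=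
    (Real.sqrt_eq_iff_mul_self_eq (by positivity) (by positivity)).2 <| by
      rw [← mul_pow, Real.mul_self_sqrt (by positivity)]
  have hsum : x ⬝ᵥ x = ∑ i, x i ^ 2 := by simp only [dotProduct, sq]
  simp only [gaussianPDF]
  rw [← ENNReal.ofReal_prod_of_nonneg fun i _ => gaussianPDFReal_nonneg _ _ _]
  simp only [gaussianPDFReal, NNReal.coe_one, mul_one, sub_zero, inv_mul_eq_div,
    Finset.prod_div_distrib, ← Real.exp_sum, Finset.prod_const, Finset.card_univ, Fintype.card_fin,
    ← Finset.sum_div, Finset.sum_neg_distrib, normalDensity, inv_one, one_mulVec, det_one, hsum,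
    hsqrt]

theorem pi_gaussianReal_eq_withDensity :
    (Measure.pi fun _ : Fin n => gaussianReal 0 1) =
      volume.withDensity fun x => ENNReal.ofReal (normalDensity 0 1 x) := by
  have hone : gaussianReal 0 1 = volume.withDensity (gaussianPDF 0 1) :=
    gaussianReal_of_var_ne_zero 0 one_ne_zero
  have hfin : IsProbabilityMeasure (volume.withDensity (gaussianPDF 0 1)) := by
    rw [← hone]; infer_instance
  rw [hone, pi_withDensity fun _ => measurable_gaussianPDF 0 1]
  simp_rw [prod_gaussianPDF_eq_normalDensity]

theorem abs_det_mul_normalDensity_mulVec {B : Matrix (Fin n) (Fin n) ℝ} (hB : B.det ≠ 0)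
    (S : Matrix (Fin n) (Fin n) ℝ) (x : Fin n → ℝ) :
    |B.det| * normalDensity 0 (B * S * Bᵀ) (B *ᵥ x) = normalDensity 0 S x := by
  have hunit : IsUnit B.det := isUnit_iff_ne_zero.2 hB
  have hform : B *ᵥ x ⬝ᵥ ((B * S * Bᵀ)⁻¹ *ᵥ (B *ᵥ x)) = x ⬝ᵥ (S⁻¹ *ᵥ x) := by
    rw [Matrix.mul_inv_rev, Matrix.mul_inv_rev, mulVec_mulVec, Matrix.mul_assoc, Matrix.mul_assoc,
      nonsing_inv_mul _ hunit, Matrix.mul_one, ← vecMul_transpose, ← dotProduct_mulVec,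
      mulVec_mulVec, ← Matrix.mul_assoc, mul_nonsing_inv _ (by rwa [det_transpose]), Matrix.one_mul]
  have hdet : Real.sqrt ((2 * Real.pi) ^ n * (B * S * Bᵀ).det) =
      |B.det| * Real.sqrt ((2 * Real.pi) ^ n * S.det) := by
    rw [det_mul, det_mul, det_transpose, ← Real.sqrt_sq_eq_abs, ← Real.sqrt_mul (sq_nonneg _)]
    ring_nf
  rw [normalDensity, normalDensity, sub_zero, sub_zero, hform, hdet, ← mul_div_assoc,
    mul_div_mul_left _ _ (abs_ne_zero.2 hB)]

theorem measurable_normalDensity (m : Fin n → ℝ) (S : Matrix (Fin n) (Fin n) ℝ) :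
    Measurable (normalDensity m S) := by
  refine Continuous.measurable ?_
  unfold normalDensity
  fun_prop

theorem map_mulVec_withDensity_normalDensity {B : Matrix (Fin n) (Fin n) ℝ} (hB : B.det ≠ 0)
    (S : Matrix (Fin n) (Fin n) ℝ) :
    (volume.withDensity fun x => ENNReal.ofReal (normalDensity 0 S x)).map (fun x => B *ᵥ x) =
      volume.withDensity fun x => ENNReal.ofReal (normalDensity 0 (B * S * Bᵀ) x) := by
  have hBm : Measurable fun x : Fin n → ℝ => B *ᵥ x :=
    (Continuous.matrix_mulVec continuous_const continuous_id).measurable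
  have hf := (measurable_normalDensity 0 (B * S * Bᵀ)).ennreal_ofReal
  have hvol : volume.map (fun x => B *ᵥ x) = ENNReal.ofReal |B.det⁻¹| • volume :=
    Real.map_matrix_volume_pi_eq_smul_volume_pi hB
  ext s hs
  rw [Measure.map_apply hBm hs, withDensity_apply _ (hBm hs), withDensity_apply _ hs]
  calc ∫⁻ x in (fun x => B *ᵥ x) ⁻¹' s, ENNReal.ofReal (normalDensity 0 S x)
      = ENNReal.ofReal |B.det| * ∫⁻ x in (fun x => B *ᵥ x) ⁻¹' s,
          ENNReal.ofReal (normalDensity 0 (B * S * Bᵀ) (B *ᵥ x)) := by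
        rw [← lintegral_const_mul' _ _ ENNReal.ofReal_ne_top]
        simp_rw [← ENNReal.ofReal_mul (abs_nonneg B.det), abs_det_mul_normalDensity_mulVec hB]
    _ = ENNReal.ofReal (|B.det| * |B.det⁻¹|) *
          ∫⁻ x in s, ENNReal.ofReal (normalDensity 0 (B * S * Bᵀ) x) := by
        rw [← setLIntegral_map hs hf hBm, hvol, Measure.restrict_smul, lintegral_smul_measure,
          smul_eq_mul, ← mul_assoc, ← ENNReal.ofReal_mul (abs_nonneg _)]
    _ = ∫⁻ x in s, ENNReal.ofReal (normalDensity 0 (B * S * Bᵀ) x) := by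
        rw [← abs_mul, mul_inv_cancel₀ hB, abs_one, ENNReal.ofReal_one, one_mul]

section Law

variable {Ω : Type*} [MeasurableSpace Ω] {P : Measure Ω} {J : Fin n → Ω → ℝ}

theorem map_toLp_eq_multivariateGaussian (hJ : HasGaussianLaw (fun ω i => J i ω) P)
    (hJ0 : ∀ i, ∫ ω, J i ω ∂P = 0) (hS : (covMatrix J P).PosSemidef) :
    P.map (fun ω => WithLp.toLp 2 fun i => J i ω) = multivariateGaussian 0 (covMatrix J P) := by
  have hP : IsProbabilityMeasure P := hJ.isProbabilityMeasure
  have hint : ∀ i, Integrable (J i) P := fun i => (hJ.eval i).integrable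
  have hlaw : HasGaussianLaw (fun ω => WithLp.toLp 2 fun i => J i ω) P :=
    hJ.map_fun (PiLp.continuousLinearEquiv 2 ℝ fun _ : Fin n => ℝ).symm.toContinuousLinearMap
  have := hlaw.isGaussian_map
  refine IsGaussian.ext ?_ ?_
  · rw [integral_map hlaw.aemeasurable (by fun_prop), integral_id_multivariateGaussian']
    ext i
    simp only [id_eq]
    rw [eval_integral_piLp]
    · exact hJ0 i
    · exact hint
  · rw [← ContinuousLinearMap.toBilinForm_inj]
    refine LinearMap.BilinForm.ext_basis (EuclideanSpace.basisFun (Fin n) ℝ).toBasis fun i j => ?_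
    simp only [OrthonormalBasis.coe_toBasis, ContinuousLinearMap.toBilinForm_apply]
    rw [covarianceBilin_apply_basisFun fun i => (hJ.eval i).memLp_two,
      covarianceBilin_multivariateGaussian hS]
    simp [covMatrix]

open MatrixOrder in
theorem multivariateGaussian_map_ofLp {S : Matrix (Fin n) (Fin n) ℝ} (hS : S.PosDef) :
    (multivariateGaussian 0 S).map WithLp.ofLp =
      volume.withDensity fun x => ENNReal.ofReal (normalDensity 0 S x) := by
  have hsq : CFC.sqrt S * CFC.sqrt S = S := CFC.sqrt_mul_sqrt_self _ hS.posSemidef.nonneg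
  have hsymm : (CFC.sqrt S)ᵀ = CFC.sqrt S := by
    rw [← conjTranspose_eq_transpose_of_trivial]
    exact (CFC.sqrt_nonneg S).isSelfAdjoint.star_eq
  have hdet : (CFC.sqrt S).det ≠ 0 := fun h => by
    have hpos := hS.det_pos
    rw [← hsq, det_mul, h, mul_zero] at hpos
    exact hpos.false
  have hmap := map_mulVec_withDensity_normalDensity hdet 1
  rw [Matrix.mul_one, hsymm, hsq, ← pi_gaussianReal_eq_withDensity] at hmap
  rw [← hmap, multivariateGaussian, ← map_pi_eq_stdGaussian, Measure.map_map (by fun_prop)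
    (by fun_prop), Measure.map_map (by fun_prop) (by fun_prop)]
  congr 1
  ext x
  simp

theorem map_eq_withDensity_normalDensity (hJ : HasGaussianLaw (fun ω i => J i ω) P)
    (hJ0 : ∀ i, ∫ ω, J i ω ∂P = 0) (hS : (covMatrix J P).PosDef) :
    P.map (fun ω i => J i ω) =
      volume.withDensity fun x => ENNReal.ofReal (normalDensity 0 (covMatrix J P) x) := by
  have hmeas : AEMeasurable (fun ω => WithLp.toLp 2 fun i => J i ω) P :=
    (PiLp.continuous_toLp 2 _).measurable.comp_aemeasurable hJ.aemeasurable
  rw [← multivariateGaussian_map_ofLp hS, ← map_toLp_eq_multivariateGaussian hJ hJ0 hS.posSemidef,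
    AEMeasurable.map_map_of_aemeasurable (by fun_prop) hmeas]
  rfl

end Law

section Bounds

variable {S : Matrix (Fin n) (Fin n) ℝ}

theorem continuousAt_matrix_inv_of_det_ne_zero (hS : S.det ≠ 0) :
    ContinuousAt (fun T : Matrix (Fin n) (Fin n) ℝ => T⁻¹) S :=
  continuousAt_matrix_inv S <| by
    simpa only [Ring.inverse_eq_inv'] using continuousAt_inv₀ hS

theorem continuousAt_normalDensity (hS : 0 < S.det) (x : Fin n → ℝ) :
    ContinuousAt (fun p : Matrix (Fin n) (Fin n) ℝ × (Fin n → ℝ) => normalDensity 0 p.1 p.2)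
      (S, x) := by
  have hinv : ContinuousAt (fun p : Matrix (Fin n) (Fin n) ℝ × (Fin n → ℝ) => p.1⁻¹) (S, x) :=
    (continuousAt_matrix_inv_of_det_ne_zero hS.ne').comp continuousAt_fst
  have hne : Real.sqrt ((2 * Real.pi) ^ n * S.det) ≠ 0 := by positivity
  unfold normalDensity
  fun_prop (disch := assumption)

theorem normalDensity_pos (hS : 0 < S.det) (m x : Fin n → ℝ) : 0 < normalDensity m S x := by
  unfold normalDensity
  positivity

theorem exists_eventually_mul_sq_norm_le (hS : S.PosDef) :
    ∃ c > 0, ∀ᶠ T in 𝓝 S, ∀ x : Fin n → ℝ, c * ‖x‖ ^ 2 ≤ x ⬝ᵥ (T *ᵥ x) := by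
  have hform : Continuous fun p : Matrix (Fin n) (Fin n) ℝ × (Fin n → ℝ) =>
      p.2 ⬝ᵥ (p.1 *ᵥ p.2) := by fun_prop
  have hsphere : IsCompact (Metric.sphere (0 : Fin n → ℝ) 1) := isCompact_sphere 0 1
  obtain ⟨m, hm, hmS⟩ : ∃ m, 0 < m ∧ ∀ u ∈ Metric.sphere (0 : Fin n → ℝ) 1, m ≤ u ⬝ᵥ (S *ᵥ u) :=
    hsphere.exists_forall_le' (by fun_prop) fun u hu =>
      hS.dotProduct_mulVec_pos (Metric.ne_of_mem_sphere hu one_ne_zero)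
  have hnear : ∀ᶠ T in 𝓝 S, ∀ u ∈ Metric.sphere (0 : Fin n → ℝ) 1, m / 2 < u ⬝ᵥ (T *ᵥ u) :=
    hsphere.eventually_forall_of_forall_eventually fun u hu =>
      hform.continuousAt.eventually (lt_mem_nhds ((half_lt_self hm).trans_le (hmS u hu)))
  refine ⟨m / 2, half_pos hm, ?_⟩
  filter_upwards [hnear] with T hT x
  rcases eq_or_ne x 0 with rfl | hx
  · simp
  · have hxn : ‖x‖ ≠ 0 := norm_ne_zero_iff.2 hx
    have hu := (hT (‖x‖⁻¹ • x) (by simp [norm_smul, hxn])).le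
    rw [mulVec_smul, smul_dotProduct, dotProduct_smul, smul_eq_mul, smul_eq_mul, ← mul_assoc,
      ← mul_inv, ← sq, inv_mul_eq_div] at hu
    exact (le_div_iff₀ (by positivity)).1 hu

theorem eventually_posDef_of_isHermitian (hS : S.PosDef) :
    ∀ᶠ T in 𝓝 S, T.IsHermitian → T.PosDef := by
  obtain ⟨c, hc, hT⟩ := exists_eventually_mul_sq_norm_le hS
  filter_upwards [hT] with T hT hsymm
  refine PosDef.of_dotProduct_mulVec_pos hsymm fun x hx => ?_
  exact (mul_pos hc (pow_pos (norm_pos_iff.2 hx) 2)).trans_le (hT x)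

theorem exists_eventually_normalDensity_le (hS : S.PosDef) :
    ∃ c > 0, ∃ C, ∀ᶠ T in 𝓝 S, ∀ x, normalDensity 0 T x ≤ C * Real.exp (-c * ‖x‖ ^ 2) := by
  have hdet : 0 < S.det := hS.det_pos
  obtain ⟨c, hc, hinv⟩ := exists_eventually_mul_sq_norm_le hS.inv
  have hsqrt : ContinuousAt
      (fun T : Matrix (Fin n) (Fin n) ℝ => (Real.sqrt ((2 * Real.pi) ^ n * T.det))⁻¹) S := by
    have hne : Real.sqrt ((2 * Real.pi) ^ n * S.det) ≠ 0 := by positivity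
    fun_prop (disch := assumption)
  refine ⟨c / 2, half_pos hc, (Real.sqrt ((2 * Real.pi) ^ n * S.det))⁻¹ + 1, ?_⟩
  filter_upwards [(continuousAt_matrix_inv_of_det_ne_zero hdet.ne').eventually hinv,
    hsqrt.eventually (gt_mem_nhds (lt_add_one _))] with T hT hC x
  rw [normalDensity, sub_zero, div_eq_inv_mul]
  gcongr
  linarith [hT x]

end Bounds

end NormalDensity

section CrossingProbabilities

variable {E : Type*}

/-- The values `z` and the marks `y` of the paths which make an upcrossing of zero in a step of
length `h` along a line from the value `z` with slope `ℓ y`, and whose mark lies in `A`. -/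
def upcrossingRegion (ℓ : E → ℝ) (A : Set E) (h : ℝ) : Set (ℝ × E) :=
  {p | p.1 ≤ 0 ∧ 0 < p.1 + h * ℓ p.2 ∧ p.2 ∈ A}

variable {ℓ : E → ℝ} {A : Set E}

theorem preimage_upcrossingRegion {h : ℝ} (hh : 0 < h) :
    (fun p : ℝ × E => (h * p.1, p.2)) ⁻¹' upcrossingRegion ℓ A h = upcrossingRegion ℓ A 1 := by
  ext p
  have hz : h * p.1 ≤ 0 ↔ p.1 ≤ 0 := smul_nonpos_iff_nonpos_of_pos_left hh
  simp only [upcrossingRegion, mem_preimage, mem_ofPred_eq, one_mul, ← mul_add,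
    mul_pos_iff_of_pos_left hh, hz]

variable [MeasurableSpace E]

theorem measurableSet_upcrossingRegion (hℓ : Measurable ℓ) (hA : MeasurableSet A) (h : ℝ) :
    MeasurableSet (upcrossingRegion ℓ A h) :=
  (measurableSet_le measurable_fst measurable_const).inter
    ((measurableSet_lt measurable_const
      (measurable_fst.add ((hℓ.comp measurable_snd).const_mul h))).inter (measurable_snd hA))

variable {μ : Measure E} [SFinite μ]

theorem lintegral_eq_ofReal_abs_mul_lintegral_comp_mul {a : ℝ} (ha : a ≠ 0) (f : ℝ → ℝ≥0∞) :
    ∫⁻ z, f z = ENNReal.ofReal |a| * ∫⁻ u, f (a * u) := by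
  conv_lhs => rw [← Real.smul_map_volume_mul_left ha]
  rw [lintegral_smul_measure, smul_eq_mul]
  congr 1
  exact lintegral_map_equiv f (MeasurableEquiv.mulLeft₀ a ha)

theorem setLIntegral_upcrossingRegion_eq (hℓ : Measurable ℓ) (hA : MeasurableSet A) {h : ℝ}
    (hh : 0 < h) {f : ℝ × E → ℝ≥0∞} (hf : Measurable f) :
    ∫⁻ p in upcrossingRegion ℓ A h, f p ∂(volume.prod μ) =
      ENNReal.ofReal h * ∫⁻ p in upcrossingRegion ℓ A 1, f (h * p.1, p.2) ∂(volume.prod μ) := by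
  have hind : Measurable ((upcrossingRegion ℓ A h).indicator f) :=
    hf.indicator (measurableSet_upcrossingRegion hℓ hA h)
  have hscaled : Measurable fun p : ℝ × E => (upcrossingRegion ℓ A h).indicator f (h * p.1, p.2) :=
    hind.comp (by fun_prop)
  have hpull : (upcrossingRegion ℓ A 1).indicator (fun p => f (h * p.1, p.2)) =
      fun p => (upcrossingRegion ℓ A h).indicator f (h * p.1, p.2) := by
    rw [← preimage_upcrossingRegion hh]
    rfl
  rw [← lintegral_indicator (measurableSet_upcrossingRegion hℓ hA h),
    ← lintegral_indicator (measurableSet_upcrossingRegion hℓ hA 1), hpull,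
    lintegral_prod_symm' _ hind, lintegral_prod_symm' _ hscaled,
    ← lintegral_const_mul' _ _ ENNReal.ofReal_ne_top]
  refine lintegral_congr fun y => ?_
  rw [lintegral_eq_ofReal_abs_mul_lintegral_comp_mul hh.ne', abs_of_pos hh]

theorem setLIntegral_upcrossingRegion_one (hℓ : Measurable ℓ) (hA : MeasurableSet A)
    {g : E → ℝ≥0∞} (hg : Measurable g) :
    ∫⁻ p in upcrossingRegion ℓ A 1, g p.2 ∂(volume.prod μ) =
      ∫⁻ y in A, ENNReal.ofReal (ℓ y) * g y ∂μ := by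
  have hm := measurableSet_upcrossingRegion hℓ hA 1
  have hind : Measurable ((upcrossingRegion ℓ A 1).indicator fun p => g p.2) :=
    (hg.comp measurable_snd).indicator hm
  rw [← lintegral_indicator hm, ← lintegral_indicator hA, lintegral_prod_symm' _ hind]
  refine lintegral_congr fun y => ?_
  have hslice : ∀ z, (upcrossingRegion ℓ A 1).indicator (fun p => g p.2) (z, y) =
      (Ioc (-ℓ y) 0).indicator (fun _ => A.indicator g y) z := fun z => by
    have hmem : (z, y) ∈ upcrossingRegion ℓ A 1 ↔ z ∈ Ioc (-ℓ y) 0 ∧ y ∈ A := by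
      simp only [upcrossingRegion, mem_ofPred_eq, mem_Ioc, one_mul, neg_lt_iff_pos_add]
      tauto
    classical simp only [indicator_apply, hmem, ite_and]
  simp_rw [hslice]
  rw [lintegral_indicator_const measurableSet_Ioc, Real.volume_Ioc, zero_sub, neg_neg, mul_comm,
    indicator_mul_right]

theorem tendsto_setLIntegral_upcrossingRegion (hℓ : Measurable ℓ) (hA : MeasurableSet A)
    {h : ℕ → ℝ} (hh : ∀ n, 0 < h n) {φ : ℕ → ℝ × E → ℝ≥0∞} (hφ : ∀ n, Measurable (φ n))
    {φ₀ G : E → ℝ≥0∞} (hφ₀ : Measurable φ₀) (hG : Measurable G)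
    (hlim : ∀ u y, Tendsto (fun n => φ n (h n * u, y)) atTop (𝓝 (φ₀ y)))
    (hle : ∀ᶠ n in atTop, ∀ p, φ n p ≤ G p.2)
    (hfin : ∫⁻ y, ENNReal.ofReal (ℓ y) * G y ∂μ ≠ ∞) :
    Tendsto (fun n => ENNReal.ofReal (h n)⁻¹ *
        ∫⁻ p in upcrossingRegion ℓ A (h n), φ n p ∂(volume.prod μ)) atTop
      (𝓝 (∫⁻ y in A, ENNReal.ofReal (ℓ y) * φ₀ y ∂μ)) := by
  have hscaled : ∀ n, ENNReal.ofReal (h n)⁻¹ *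
      ∫⁻ p in upcrossingRegion ℓ A (h n), φ n p ∂(volume.prod μ) =
        ∫⁻ p in upcrossingRegion ℓ A 1, φ n (h n * p.1, p.2) ∂(volume.prod μ) := fun n => by
    rw [setLIntegral_upcrossingRegion_eq hℓ hA (hh n) (hφ n), ← mul_assoc,
      ← ENNReal.ofReal_mul (inv_nonneg.2 (hh n).le), inv_mul_cancel₀ (hh n).ne',
      ENNReal.ofReal_one, one_mul]
  have hbound : ∫⁻ p in upcrossingRegion ℓ A 1, G p.2 ∂(volume.prod μ) ≠ ∞ := by
    rw [setLIntegral_upcrossingRegion_one hℓ hA hG]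
    exact ne_top_of_le_ne_top hfin (setLIntegral_le_lintegral _ _)
  simp_rw [hscaled]
  rw [← setLIntegral_upcrossingRegion_one hℓ hA hφ₀]
  refine tendsto_lintegral_filter_of_dominated_convergence (fun p => G p.2)
    (Eventually.of_forall fun n => (hφ n).comp (by fun_prop)) ?_ hbound
    (Eventually.of_forall fun p => hlim p.1 p.2)
  filter_upwards [hle] with n hn using Eventually.of_forall fun p => hn _

end CrossingProbabilities

section GaussianTriples

theorem measurePreserving_vecCons3 :
    MeasurePreserving (fun p : ℝ × (ℝ × ℝ) => (![p.1, p.2.1, p.2.2] : Fin 3 → ℝ)) := by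
  have hsplit := (volume_preserving_piFinSuccAbove (fun _ : Fin 3 => ℝ) 0).symm.comp
    ((MeasurePreserving.id (volume : Measure ℝ)).prod (volume_preserving_finTwoArrow ℝ).symm)
  rw [Measure.volume_eq_prod]
  convert hsplit using 1
  ext p i
  fin_cases i <;> rfl

variable {Ω : Type*} [MeasurableSpace Ω] {P : Measure Ω}

theorem measure_triple_mem_eq_setLIntegral {J : Fin 3 → Ω → ℝ}
    (hJ : HasGaussianLaw (fun ω i => J i ω) P) (hJ0 : ∀ i, ∫ ω, J i ω ∂P = 0)
    (hS : (covMatrix J P).PosDef) {B : Set (ℝ × (ℝ × ℝ))} (hB : MeasurableSet B) :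
    P {ω | (J 0 ω, J 1 ω, J 2 ω) ∈ B} =
      ∫⁻ p in B, ENNReal.ofReal (normalDensity 0 (covMatrix J P) ![p.1, p.2.1, p.2.2]) := by
  set B' : Set (Fin 3 → ℝ) := {x | (x 0, x 1, x 2) ∈ B}
  have hB' : MeasurableSet B' := hB.preimage (by fun_prop)
  calc P {ω | (J 0 ω, J 1 ω, J 2 ω) ∈ B} = P.map (fun ω i => J i ω) B' :=
        (Measure.map_apply_of_aemeasurable hJ.aemeasurable hB').symm
    _ = ∫⁻ x in B', ENNReal.ofReal (normalDensity 0 (covMatrix J P) x) := by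
        rw [map_eq_withDensity_normalDensity hJ hJ0 hS, withDensity_apply _ hB']
    _ = _ := (measurePreserving_vecCons3.setLIntegral_comp_preimage hB'
        (measurable_normalDensity _ _).ennreal_ofReal).symm

theorem integrable_norm_mul_exp_neg_mul_sq_norm {E : Type*} [NormedAddCommGroup E]
    [NormedSpace ℝ E] [FiniteDimensional ℝ E] [Nontrivial E] [MeasurableSpace E] [BorelSpace E]
    (μ : Measure E) [μ.IsAddHaarMeasure] {c : ℝ} (hc : 0 < c) :
    Integrable (fun y => ‖y‖ * Real.exp (-c * ‖y‖ ^ 2)) μ := by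
  rw [integrable_fun_norm_addHaar μ (f := fun r => r * Real.exp (-c * r ^ 2))]
  refine (integrableOn_rpow_mul_exp_neg_mul_sq hc (s := Module.finrank ℝ E)
    (by linarith [Nat.cast_nonneg (α := ℝ) (Module.finrank ℝ E)])).congr_fun (fun r _ => ?_)
    measurableSet_Ioi
  simp only [Real.rpow_natCast]
  rw [smul_eq_mul, ← mul_assoc, ← pow_succ,
    Nat.sub_add_cancel Module.finrank_pos]

variable {S : Matrix (Fin 3) (Fin 3) ℝ}

theorem exists_eventually_normalDensity_le_of_marks (hS : S.PosDef) (ℓ : ℝ × ℝ →L[ℝ] ℝ) :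
    ∃ G : ℝ × ℝ → ℝ≥0∞, Measurable G ∧ ∫⁻ y, ENNReal.ofReal (ℓ y) * G y ≠ ∞ ∧
      ∀ᶠ T in 𝓝 S, ∀ z y, ENNReal.ofReal (normalDensity 0 T ![z, y.1, y.2]) ≤ G y := by
  obtain ⟨c, hc, C, hC⟩ := exists_eventually_normalDensity_le hS
  have hC0 : 0 ≤ C := by
    have := (normalDensity_pos hS.det_pos 0 0).le.trans (hC.self_of_nhds 0)
    exact nonneg_of_mul_nonneg_left this (Real.exp_pos _)
  have hnorm : ∀ (z : ℝ) (y : ℝ × ℝ), ‖y‖ ≤ ‖![z, y.1, y.2]‖ := fun z y =>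
    max_le (norm_le_pi_norm ![z, y.1, y.2] 1) (norm_le_pi_norm ![z, y.1, y.2] 2)
  refine ⟨fun y => ENNReal.ofReal (C * Real.exp (-c * ‖y‖ ^ 2)), by fun_prop, ?_, ?_⟩
  · have hint := ((integrable_norm_mul_exp_neg_mul_sq_norm
      (volume : Measure (ℝ × ℝ)) hc).const_mul (‖ℓ‖ * C)).lintegral_lt_top
    refine ne_top_of_le_ne_top hint.ne (lintegral_mono fun y => ?_)
    rw [← ENNReal.ofReal_mul' (by positivity)]
    refine ENNReal.ofReal_le_ofReal ?_
    calc ℓ y * (C * Real.exp (-c * ‖y‖ ^ 2)) ≤ ‖ℓ‖ * ‖y‖ * (C * Real.exp (-c * ‖y‖ ^ 2)) := by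
          gcongr
          exact (le_abs_self _).trans (ℓ.le_opNorm y)
      _ = ‖ℓ‖ * C * (‖y‖ * Real.exp (-c * ‖y‖ ^ 2)) := by ring
  · filter_upwards [hC] with T hT z y
    refine ENNReal.ofReal_le_ofReal ((hT _).trans ?_)
    have := hnorm z y
    simp only [neg_mul]
    gcongr

/-- The intensity measure of the marks at the zero upcrossings of a stationary process, when `S` is
the covariance matrix of its value and its (two-dimensional) mark at a fixed time, and `ℓ` of the
mark is its derivative. -/
noncomputable def markIntensity (S : Matrix (Fin 3) (Fin 3) ℝ) (ℓ : ℝ × ℝ →L[ℝ] ℝ) :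
    Measure (ℝ × ℝ) :=
  volume.withDensity fun y =>
    ENNReal.ofReal (ℓ y) * ENNReal.ofReal (normalDensity 0 S ![0, y.1, y.2])

theorem measurable_normalDensity_vec (S : Matrix (Fin 3) (Fin 3) ℝ) (z : ℝ) :
    Measurable fun y : ℝ × ℝ => normalDensity 0 S ![z, y.1, y.2] :=
  (measurable_normalDensity 0 S).comp (by fun_prop)

theorem isFiniteMeasure_markIntensity (hS : S.PosDef) (ℓ : ℝ × ℝ →L[ℝ] ℝ) :
    IsFiniteMeasure (markIntensity S ℓ) := by
  obtain ⟨G, -, hfin, hle⟩ := exists_eventually_normalDensity_le_of_marks hS ℓ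
  refine isFiniteMeasure_withDensity (ne_top_of_le_ne_top hfin (lintegral_mono fun y => ?_))
  gcongr
  exact hle.self_of_nhds 0 y

theorem markIntensity_compl_pos (S : Matrix (Fin 3) (Fin 3) ℝ) (ℓ : ℝ × ℝ →L[ℝ] ℝ) :
    markIntensity S ℓ {y | 0 < ℓ y}ᶜ = 0 := by
  have hm : MeasurableSet {y | 0 < ℓ y} := measurableSet_lt measurable_const ℓ.measurable
  rw [markIntensity, withDensity_apply _ hm.compl]
  refine setLIntegral_eq_zero hm.compl fun y hy => ?_
  rw [ENNReal.ofReal_of_nonpos (not_lt.1 hy), zero_mul, Pi.zero_apply]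

theorem markIntensity_pos {S : Matrix (Fin 3) (Fin 3) ℝ} (hS : 0 < S.det) {ℓ : ℝ × ℝ →L[ℝ] ℝ}
    {U : Set (ℝ × ℝ)} (hU : IsOpen U) {y : ℝ × ℝ} (hyU : y ∈ U) (hy : 0 < ℓ y) :
    0 < markIntensity S ℓ U := by
  have hO : IsOpen (U ∩ {y | 0 < ℓ y}) := hU.inter (isOpen_lt continuous_const ℓ.continuous)
  refine lt_of_lt_of_le ?_ (measure_mono (inter_subset_left : U ∩ {y | 0 < ℓ y} ⊆ U))
  have hdensity := ℓ.measurable.ennreal_ofReal.mul (measurable_normalDensity_vec S 0).ennreal_ofReal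
  rw [markIntensity, withDensity_apply _ hO.measurableSet]
  refine (setLIntegral_pos_iff hdensity).2 ?_
  refine (hO.measure_pos volume ⟨y, hyU, hy⟩).trans_le (measure_mono fun y hy => ⟨?_, hy⟩)
  exact mul_ne_zero (ENNReal.ofReal_pos.2 hy.2).ne'
    (ENNReal.ofReal_pos.2 (normalDensity_pos hS 0 _)).ne'

theorem integral_indicator_max_mul_normalDensity {S : Matrix (Fin 3) (Fin 3) ℝ} (hS : 0 < S.det)
    (ℓ : ℝ × ℝ →L[ℝ] ℝ) {A : Set (ℝ × ℝ)} (hA : MeasurableSet A) :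
    ∫ y, A.indicator (fun y => max (ℓ y) 0) y * normalDensity 0 S ![0, y.1, y.2] =
      (markIntensity S ℓ A).toReal := by
  simp_rw [← indicator_mul_left A (fun y => max (ℓ y) 0) fun y : ℝ × ℝ =>
    normalDensity 0 S ![0, y.1, y.2]]
  rw [integral_indicator hA, markIntensity, withDensity_apply _ hA,
    integral_eq_lintegral_of_nonneg_ae
      (ae_of_all _ fun y => mul_nonneg (le_max_right _ _) (normalDensity_pos hS 0 _).le)
      ((ℓ.measurable.max measurable_const).mul
        (measurable_normalDensity_vec S 0)).aestronglyMeasurable]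
  simp_rw [ENNReal.ofReal_mul (le_max_right _ _), ENNReal.ofReal_max, ENNReal.ofReal_zero,
    max_zero]

theorem tendsto_normalDensity_mul (hS : 0 < S.det) {T : ℕ → Matrix (Fin 3) (Fin 3) ℝ}
    (hT : Tendsto T atTop (𝓝 S)) {h : ℕ → ℝ} (hh : Tendsto h atTop (𝓝 0)) (u : ℝ) (y : ℝ × ℝ) :
    Tendsto (fun n => normalDensity 0 (T n) ![h n * u, y.1, y.2]) atTop
      (𝓝 (normalDensity 0 S ![0, y.1, y.2])) := by
  have hz : Tendsto (fun n => h n * u) atTop (𝓝 0) := by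
    simpa only [zero_mul] using hh.mul_const u
  have hvec : Continuous fun z : ℝ => (![z, y.1, y.2] : Fin 3 → ℝ) := by fun_prop
  have hx : Tendsto (fun n => (![h n * u, y.1, y.2] : Fin 3 → ℝ)) atTop (𝓝 ![0, y.1, y.2]) :=
    (hvec.tendsto 0).comp hz
  have hlim := (continuousAt_normalDensity hS ![0, y.1, y.2]).tendsto.comp (hT.prodMk_nhds hx)
  exact hlim

theorem tendsto_measure_triple_mem_upcrossingRegion {X : ℕ → Fin 3 → Ω → ℝ}
    (hX : ∀ n, HasGaussianLaw (fun ω i => X n i ω) P) (hX0 : ∀ n i, ∫ ω, X n i ω ∂P = 0)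
    (hcov : Tendsto (fun n => covMatrix (X n) P) atTop (𝓝 S)) (hS : S.PosDef) {h : ℕ → ℝ}
    (hh : ∀ n, 0 < h n) (hh0 : Tendsto h atTop (𝓝 0)) (ℓ : ℝ × ℝ →L[ℝ] ℝ) {A : Set (ℝ × ℝ)}
    (hA : MeasurableSet A) :
    Tendsto (fun n => ENNReal.ofReal (h n)⁻¹ *
        P {ω | (X n 0 ω, X n 1 ω, X n 2 ω) ∈ upcrossingRegion ℓ A (h n)}) atTop
      (𝓝 (markIntensity S ℓ A)) := by
  have hℓ : Measurable ℓ := ℓ.continuous.measurable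
  obtain ⟨G, hG, hfin, hle⟩ := exists_eventually_normalDensity_le_of_marks hS ℓ
  have hpos : ∀ᶠ n in atTop, (covMatrix (X n) P).PosDef := by
    filter_upwards [hcov.eventually (eventually_posDef_of_isHermitian hS)] with n hn
    exact hn (Matrix.ext fun i j => covariance_comm _ _)
  have hlim := tendsto_setLIntegral_upcrossingRegion (μ := volume) hℓ hA hh
    (φ := fun n p => ENNReal.ofReal (normalDensity 0 (covMatrix (X n) P) ![p.1, p.2.1, p.2.2]))
    (fun n => ((measurable_normalDensity _ _).comp (by fun_prop)).ennreal_ofReal)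
    (measurable_normalDensity_vec S 0).ennreal_ofReal hG
    (fun u y => ENNReal.tendsto_ofReal (tendsto_normalDensity_mul hS.det_pos hcov hh0 u y))
    ((hcov.eventually hle).mono fun n hn p => hn p.1 p.2) hfin
  rw [markIntensity, withDensity_apply _ hA]
  refine hlim.congr' ?_
  filter_upwards [hpos] with n hn
  rw [measure_triple_mem_eq_setLIntegral (hX n) (hX0 n) hn
    (measurableSet_upcrossingRegion hℓ hA _)]
  rfl

end GaussianTriples

section DifferenceJets

variable {Ω : Type*} {W : ℝ × ℝ → Ω → ℝ}

/-- The points, relative to a position of the ship, at which the field determines an up-step of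
length `h` of the encountered sea together with its mark. -/
def stencil (v h : ℝ) : Fin 3 → ℝ × ℝ := ![(0, 0), (h, 0), (v * h, h)]

/-- The value of the field at the origin, with the mark of the step of length `h` from time `0`: a
discrete version of `jet`. -/
noncomputable def diffJet (W : ℝ × ℝ → Ω → ℝ) (v h : ℝ) : Fin 3 → Ω → ℝ :=
  ![W (0, 0), fun ω => (diffMark (fun p => W p ω) v h 0).1,
    fun ω => (diffMark (fun p => W p ω) v h 0).2]

/-- The difference jet as a linear function of the values of the field on the stencil. -/
noncomputable def diffJetCLM (v h : ℝ) : (Fin 3 → ℝ) →L[ℝ] (Fin 3 → ℝ) :=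
  ContinuousLinearMap.pi
    ![.proj 0, h⁻¹ • (.proj 1 - .proj 0),
      h⁻¹ • (.proj 2 - .proj 0) - (v * h⁻¹) • (.proj 1 - .proj 0)]

theorem diffJet_eq (v h : ℝ) :
    (fun ω i => diffJet W v h i ω) = fun ω => diffJetCLM v h fun i => W (stencil v h i) ω := by
  ext ω i
  fin_cases i
  · simp [diffJet, diffJetCLM, stencil]
  · simp [diffJet, diffJetCLM, diffMark, stencil, div_eq_inv_mul]
  · simp [diffJet, diffJetCLM, diffMark, stencil, div_eq_inv_mul, mul_assoc]

/-- The derivative of the encountered sea as a function of the slope and the time derivative of the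
field. -/
noncomputable def courseSlope (v : ℝ) : ℝ × ℝ →L[ℝ] ℝ :=
  v • ContinuousLinearMap.fst ℝ ℝ ℝ + ContinuousLinearMap.snd ℝ ℝ ℝ

theorem courseSlope_apply (v : ℝ) (y : ℝ × ℝ) : courseSlope v y = v * y.1 + y.2 := rfl

/-- The event that the encountered sea makes an up-step of length `h` from time `s` with mark
in `A`. -/
def seaUpStep (W : ℝ × ℝ → Ω → ℝ) (v : ℝ) (A : Set (ℝ × ℝ)) (h s : ℝ) : Set Ω :=
  {ω | UpStep (fun t => encSea W v t ω) (diffMark (fun p => W p ω) v) A h s}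

theorem encSea_add (v : ℝ) {h : ℝ} (hh : h ≠ 0) (s : ℝ) (ω : Ω) :
    encSea W v (s + h) ω =
      encSea W v s ω + h * courseSlope v (diffMark (fun p => W p ω) v h s) := by
  simp only [courseSlope_apply, diffMark, encSea]
  field_simp
  ring

theorem seaUpStep_zero_eq (v : ℝ) {h : ℝ} (hh : h ≠ 0) (A : Set (ℝ × ℝ)) :
    seaUpStep W v A h 0 = {ω | (diffJet W v h 0 ω, diffJet W v h 1 ω, diffJet W v h 2 ω) ∈
      upcrossingRegion (courseSlope v) A h} := by
  ext ω
  have hvalue : encSea W v 0 ω = W (0, 0) ω := by rw [encSea, mul_zero]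
  simp only [seaUpStep, UpStep, mem_ofPred_eq, encSea_add v hh, hvalue]
  rfl

/-- The values of the field on the stencil which amount to an up-step with mark in `A`. -/
def upStepValues (v h : ℝ) (A : Set (ℝ × ℝ)) : Set (Fin 3 → ℝ) :=
  {x | x 0 ≤ 0 ∧ 0 < x 2 ∧ ((x 1 - x 0) / h, (x 2 - x 0) / h - v * ((x 1 - x 0) / h)) ∈ A}

theorem measurableSet_upStepValues (v h : ℝ) {A : Set (ℝ × ℝ)} (hA : MeasurableSet A) :
    MeasurableSet (upStepValues v h A) := by
  have hmark : Measurable fun x : Fin 3 → ℝ =>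
      ((x 1 - x 0) / h, (x 2 - x 0) / h - v * ((x 1 - x 0) / h)) := by fun_prop
  exact (measurableSet_le (measurable_pi_apply 0) measurable_const).inter
    ((measurableSet_lt measurable_const (measurable_pi_apply 2)).inter (hmark hA))

theorem seaUpStep_eq_preimage (v h s : ℝ) (A : Set (ℝ × ℝ)) :
    seaUpStep W v A h s =
      (fun ω i => W (stencil v h i + (v * s, s)) ω) ⁻¹' upStepValues v h A := by
  ext ω
  have hstart : ((0 : ℝ), (0 : ℝ)) + (v * s, s) = (v * s, s) := by
    rw [← Prod.zero_eq_mk, zero_add]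
  have hspace : (h, (0 : ℝ)) + (v * s, s) = (v * s + h, s) := by
    rw [Prod.mk_add_mk, zero_add, add_comm]
  have hcourse : (v * h, h) + (v * s, s) = (v * (s + h), s + h) := by
    rw [Prod.mk_add_mk, ← mul_add, add_comm]
  simp [seaUpStep, UpStep, upStepValues, stencil, encSea, diffMark, hstart, hspace, hcourse]

variable [MeasurableSpace Ω] {P : Measure Ω}

theorem IsGaussianSea.hasGaussianLaw_pi (hW : IsGaussianSea W P) {n : ℕ} (p : Fin n → ℝ × ℝ) :
    HasGaussianLaw (fun ω i => W (p i) ω) P :=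
  ((hW.gaussian.comp_right p).hasGaussianLaw Finset.univ).map_fun
    (ContinuousLinearMap.pi fun i =>
      ContinuousLinearMap.proj (R := ℝ) (φ := fun _ : (Finset.univ : Finset (Fin n)) => ℝ)
        ⟨i, Finset.mem_univ i⟩)

theorem IsGaussianSea.hasGaussianLaw_diffJet (hW : IsGaussianSea W P) (v h : ℝ) :
    HasGaussianLaw (fun ω i => diffJet W v h i ω) P := by
  rw [diffJet_eq]
  exact (hW.hasGaussianLaw_pi _).map_fun _

theorem IsGaussianSea.integral_diffJet (hW : IsGaussianSea W P) (v h : ℝ) (i : Fin 3) :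
    ∫ ω, diffJet W v h i ω ∂P = 0 := by
  have hstencil := hW.hasGaussianLaw_pi (stencil v h)
  have hmean : ∫ ω, (fun j => W (stencil v h j) ω) ∂P = 0 := by
    ext j
    rw [eval_integral fun j => (hstencil.eval j).integrable]
    exact hW.mean_zero _
  rw [← eval_integral fun j => ((hW.hasGaussianLaw_diffJet v h).eval j).integrable, diffJet_eq,
    ContinuousLinearMap.integral_comp_comm _ hstencil.integrable, hmean, map_zero, Pi.zero_apply]

theorem IsGaussianSea.tendsto_diffJet (hW : IsGaussianSea W P) (v : ℝ) (i : Fin 3) :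
    ∀ᵐ ω ∂P, Tendsto (fun n : ℕ => diffJet W v ((1 / 2) ^ n) i ω) atTop (𝓝 (jet W i ω)) := by
  filter_upwards [hW.contDiff] with ω hω
  have hmark := (tendsto_diffMark hω v 0).comp
    (tendsto_half_pow.prodMk (tendsto_const_nhds (x := (0 : ℝ))))
  rw [mul_zero] at hmark
  fin_cases i
  · exact tendsto_const_nhds
  · exact (continuous_fst.tendsto _).comp hmark
  · exact (continuous_snd.tendsto _).comp hmark

theorem IsGaussianSea.meanVec_jet (hW : IsGaussianSea W P) : meanVec (jet W) P = 0 := by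
  ext i
  exact (hasGaussianLaw_of_tendsto_ae (fun n => (hW.hasGaussianLaw_diffJet 0 _).eval i)
    (fun n => hW.integral_diffJet 0 _ i) (hW.tendsto_diffJet 0 i)).2.1

theorem IsGaussianSea.tendsto_covMatrix_diffJet (hW : IsGaussianSea W P) (v : ℝ) :
    Tendsto (fun n : ℕ => covMatrix (diffJet W v ((1 / 2) ^ n)) P) atTop
      (𝓝 (covMatrix (jet W) P)) :=
  tendsto_pi_nhds.2 fun i => tendsto_pi_nhds.2 fun j =>
    tendsto_covariance_of_tendsto_ae (fun _ => hW.hasGaussianLaw_diffJet v _)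
      (fun _ => hW.integral_diffJet v _) (hW.tendsto_diffJet v) i j

theorem IsGaussianSea.tendsto_measure_seaUpStep (hW : IsGaussianSea W P)
    (hS : (covMatrix (jet W) P).PosDef) (v : ℝ) {A : Set (ℝ × ℝ)} (hA : MeasurableSet A) :
    Tendsto (fun n : ℕ => 2 ^ n * P (seaUpStep W v A ((1 / 2) ^ n) 0)) atTop
      (𝓝 (markIntensity (covMatrix (jet W) P) (courseSlope v) A)) := by
  have hpos : ∀ n : ℕ, (0 : ℝ) < (1 / 2) ^ n := fun n => by positivity
  refine (tendsto_measure_triple_mem_upcrossingRegion (fun n => hW.hasGaussianLaw_diffJet v _)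
    (fun n => hW.integral_diffJet v _) (hW.tendsto_covMatrix_diffJet v) hS hpos
    (tendsto_half_pow.mono_right nhdsWithin_le_nhds) (courseSlope v) hA).congr fun n => ?_
  rw [seaUpStep_zero_eq v (hpos n).ne', ← inv_pow, one_div, inv_inv,
    ENNReal.ofReal_pow zero_le_two, ENNReal.ofReal_ofNat]

theorem IsGaussianSea.nullMeasurableSet_seaUpStep (hW : IsGaussianSea W P) (v h s : ℝ)
    {A : Set (ℝ × ℝ)} (hA : MeasurableSet A) : NullMeasurableSet (seaUpStep W v A h s) P := by
  rw [seaUpStep_eq_preimage]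
  exact (aemeasurable_pi_lambda _ fun i => hW.gaussian.aemeasurable _).nullMeasurableSet_preimage
    (measurableSet_upStepValues v h hA)

theorem IsGaussianSea.measure_seaUpStep_eq (hW : IsGaussianSea W P) (v h s : ℝ)
    {A : Set (ℝ × ℝ)} (hA : MeasurableSet A) :
    P (seaUpStep W v A h s) = P (seaUpStep W v A h 0) := by
  have hshift := fun s => (hW.stationary (v * s, s) 3 (stencil v h)).measure_mem_eq
    (measurableSet_upStepValues v h hA)
  rw [seaUpStep_eq_preimage, seaUpStep_eq_preimage, hshift, hshift]

theorem IsGaussianSea.encSea_ne_zero (hW : IsGaussianSea W P)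
    (hvar : Var[W (0, 0); P] ≠ 0) (v t : ℝ) : ∀ᵐ ω ∂P, encSea W v t ω ≠ 0 := by
  have hlaw : HasGaussianLaw (W (0, 0)) P := (hW.hasGaussianLaw_pi fun _ : Fin 1 => (0, 0)).eval 0
  have hne : Var[W (0, 0); P].toNNReal ≠ 0 :=
    (Real.toNNReal_pos.2 (lt_of_le_of_ne (variance_nonneg _ _) hvar.symm)).ne'
  have horigin : P (W (0, 0) ⁻¹' {0}) = 0 := by
    rw [← Measure.map_apply_of_aemeasurable hlaw.aemeasurable (measurableSet_singleton _),
      hlaw.map_eq_gaussianReal]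
    have := nullSingletonClass_gaussianReal (μ := ∫ ω, W (0, 0) ω ∂P) hne
    exact measure_singleton 0
  have hzero : MeasurableSet {x : Fin 1 → ℝ | x 0 = 0} :=
    measurableSet_eq_fun (measurable_pi_apply 0) measurable_const
  have hshift := (hW.stationary (v * t, t) 1 fun _ => (0, 0)).measure_mem_eq hzero
  simp only [← Prod.zero_eq_mk, zero_add] at hshift
  rw [ae_iff]
  simp only [not_not]
  exact hshift.trans horigin

end DifferenceJets

theorem limsup_lintegral_le_of_aemeasurable {Ω : Type*} [MeasurableSpace Ω] {P : Measure Ω}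
    {f : ℕ → Ω → ℝ≥0∞} (g : Ω → ℝ≥0∞) (hf : ∀ n, AEMeasurable (f n) P)
    (hfg : ∀ n, f n ≤ᵐ[P] g) (hg : ∫⁻ ω, g ω ∂P ≠ ∞) :
    limsup (fun n => ∫⁻ ω, f n ω ∂P) atTop ≤ ∫⁻ ω, limsup (fun n => f n ω) atTop ∂P := by
  have hmk := limsup_lintegral_le (f := fun n => (hf n).mk (f n)) g (fun n => (hf n).measurable_mk)
    (fun n => (hf n).ae_eq_mk.symm.le.trans (hfg n)) hg
  simp_rw [← lintegral_congr_ae (hf _).ae_eq_mk] at hmk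
  refine hmk.trans_eq (lintegral_congr_ae ?_)
  filter_upwards [ae_all_iff.2 fun n => (hf n).ae_eq_mk] with ω hω
  simp_rw [hω]

section RiceFormula

variable {Ω : Type*} {W : ℝ × ℝ → Ω → ℝ}

/-- The number of cells of the dyadic partition of `[0, 1]` of order `n` over which the encountered
sea makes an up-step with mark in `A`. -/
noncomputable def seaCount (W : ℝ × ℝ → Ω → ℝ) (v : ℝ) (A : Set (ℝ × ℝ)) (n : ℕ) (ω : Ω) : ℝ≥0∞ :=
  (upCells (fun t => encSea W v t ω) (diffMark (fun p => W p ω) v) A n).card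

/-- The upcrossings of zero by the encountered sea in `[0, 1]` at which the gradient `(W_x, W_t)`
belongs to `A`. -/
def seaUpcrossings (W : ℝ × ℝ → Ω → ℝ) (v : ℝ) (A : Set (ℝ × ℝ)) (ω : Ω) : Set ℝ :=
  markedUpcrossings (fun t => encSea W v t ω)
    (fun t => courseSlope v (Wx W (v * t) t ω, Wt W (v * t) t ω))
    (fun t => (Wx W (v * t) t ω, Wt W (v * t) t ω)) A

theorem seaUpcrossings_mono (v : ℝ) {A B : Set (ℝ × ℝ)} (hAB : A ⊆ B) (ω : Ω) :
    seaUpcrossings W v A ω ⊆ seaUpcrossings W v B ω :=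
  fun _ ht => ⟨ht.1, ht.2.1, ht.2.2.1, hAB ht.2.2.2⟩

theorem seaCount_le_seaCount_univ (v : ℝ) (A : Set (ℝ × ℝ)) (n : ℕ) (ω : Ω) :
    seaCount W v A n ω ≤ seaCount W v univ n ω :=
  Nat.cast_le.2 (Finset.card_le_card (upCells_mono (subset_univ A) n))

theorem monotone_seaCount_univ (v : ℝ) (ω : Ω) : Monotone fun n => seaCount W v univ n ω :=
  fun _ _ hn => Nat.cast_le.2 (monotone_card_upCells hn)

theorem seaCount_eq_sum (v : ℝ) (A : Set (ℝ × ℝ)) (n : ℕ) :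
    seaCount W v A n = fun ω => ∑ k ∈ Finset.range (2 ^ n),
      (seaUpStep W v A ((1 / 2) ^ n) (k * (1 / 2) ^ n)).indicator 1 ω := by
  classical
  ext ω
  rw [seaCount, upCells, Finset.card_filter, Nat.cast_sum]
  refine Finset.sum_congr rfl fun k _ => ?_
  simp only [indicator_apply, seaUpStep, mem_ofPred_eq, Pi.one_apply, Nat.cast_ite, Nat.cast_one,
    Nat.cast_zero]

theorem eventually_seaCount_le_encard {ω : Ω} (hω : ContDiff ℝ 1 fun p => W p ω) (v : ℝ)
    {K : Set (ℝ × ℝ)} (hK : IsClosed K) (hpos : ∀ y ∈ K, 0 < courseSlope v y) :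
    ∀ᶠ n in atTop, seaCount W v K n ω ≤ (seaUpcrossings W v K ω).encard := by
  filter_upwards [eventually_card_upCells_le_encard hK (hasStrictDerivAt_course hω v)
    (tendsto_diffMark hω v) fun t ht => hpos _ ht] with n hn
  exact ENat.toENNReal_le.2 hn

variable [MeasurableSpace Ω] {P : Measure Ω}

theorem IsGaussianSea.aemeasurable_seaCount (hW : IsGaussianSea W P) (v : ℝ) {A : Set (ℝ × ℝ)}
    (hA : MeasurableSet A) (n : ℕ) : AEMeasurable (seaCount W v A n) P := by
  rw [seaCount_eq_sum]
  exact Finset.aemeasurable_fun_sum _ fun k _ =>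
    aemeasurable_const.indicator₀ (hW.nullMeasurableSet_seaUpStep v _ _ hA)

theorem IsGaussianSea.lintegral_seaCount (hW : IsGaussianSea W P) (v : ℝ) {A : Set (ℝ × ℝ)}
    (hA : MeasurableSet A) (n : ℕ) :
    ∫⁻ ω, seaCount W v A n ω ∂P = 2 ^ n * P (seaUpStep W v A ((1 / 2) ^ n) 0) := by
  have hnull := fun s => hW.nullMeasurableSet_seaUpStep v ((1 / 2) ^ n) s hA
  calc ∫⁻ ω, seaCount W v A n ω ∂P
      = ∑ k ∈ Finset.range (2 ^ n), P (seaUpStep W v A ((1 / 2) ^ n) (k * (1 / 2) ^ n)) := by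
        rw [seaCount_eq_sum, lintegral_finsetSum' _ fun k _ =>
          measurable_one.aemeasurable.indicator₀ (hnull _)]
        exact Finset.sum_congr rfl fun k _ => lintegral_indicator_one₀ (hnull _)
    _ = ∑ k ∈ Finset.range (2 ^ n), P (seaUpStep W v A ((1 / 2) ^ n) 0) :=
        Finset.sum_congr rfl fun k _ => hW.measure_seaUpStep_eq v _ _ hA
    _ = 2 ^ n * P (seaUpStep W v A ((1 / 2) ^ n) 0) := by
        rw [Finset.sum_const, Finset.card_range, nsmul_eq_mul, Nat.cast_pow, Nat.cast_ofNat]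

theorem IsGaussianSea.tendsto_lintegral_seaCount (hW : IsGaussianSea W P)
    (hS : (covMatrix (jet W) P).PosDef) (v : ℝ) {A : Set (ℝ × ℝ)} (hA : MeasurableSet A) :
    Tendsto (fun n => ∫⁻ ω, seaCount W v A n ω ∂P) atTop
      (𝓝 (markIntensity (covMatrix (jet W) P) (courseSlope v) A)) := by
  simp_rw [hW.lintegral_seaCount v hA]
  exact hW.tendsto_measure_seaUpStep hS v hA

theorem IsGaussianSea.lintegral_iSup_seaCount_ne_top (hW : IsGaussianSea W P)
    (hS : (covMatrix (jet W) P).PosDef) (v : ℝ) :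
    ∫⁻ ω, ⨆ n, seaCount W v univ n ω ∂P ≠ ∞ := by
  have := isFiniteMeasure_markIntensity hS (courseSlope v)
  have hlim := tendsto_atTop_iSup fun (m n : ℕ) (hmn : m ≤ n) =>
    lintegral_mono (μ := P) fun ω => monotone_seaCount_univ (W := W) v ω hmn
  rw [lintegral_iSup' (hW.aemeasurable_seaCount v .univ) (ae_of_all _ (monotone_seaCount_univ v)),
    tendsto_nhds_unique hlim (hW.tendsto_lintegral_seaCount hS v .univ)]
  exact measure_ne_top _ _

theorem IsGaussianSea.variance_ne_zero (hW : IsGaussianSea W P)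
    (hS : (covMatrix (jet W) P).PosDef) : Var[W (0, 0); P] ≠ 0 := by
  have hdiag : 0 < covMatrix (jet W) P 0 0 := hS.diag_pos
  rw [← covariance_self (hW.gaussian.aemeasurable _)]
  exact hdiag.ne'

theorem IsGaussianSea.lintegral_encard_seaUpcrossings_le (hW : IsGaussianSea W P)
    (hS : (covMatrix (jet W) P).PosDef) (v : ℝ) {U : Set (ℝ × ℝ)} (hU : IsOpen U) :
    ∫⁻ ω, ((seaUpcrossings W v U ω).encard : ℝ≥0∞) ∂P ≤
      markIntensity (covMatrix (jet W) P) (courseSlope v) U :=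
  calc ∫⁻ ω, ((seaUpcrossings W v U ω).encard : ℝ≥0∞) ∂P
      ≤ ∫⁻ ω, liminf (fun n => seaCount W v U n ω) atTop ∂P := by
        refine lintegral_mono_ae ?_
        filter_upwards [hW.contDiff, hW.encSea_ne_zero (hW.variance_ne_zero hS) v 1] with ω hω hone
        exact encard_markedUpcrossings_le_liminf hU (hasStrictDerivAt_course hω v)
          (tendsto_diffMark hω v) hone
    _ ≤ liminf (fun n => ∫⁻ ω, seaCount W v U n ω ∂P) atTop :=
        lintegral_liminf_le' (hW.aemeasurable_seaCount v hU.measurableSet)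
    _ = markIntensity (covMatrix (jet W) P) (courseSlope v) U :=
        (hW.tendsto_lintegral_seaCount hS v hU.measurableSet).liminf_eq

theorem IsGaussianSea.le_lintegral_encard_seaUpcrossings (hW : IsGaussianSea W P)
    (hS : (covMatrix (jet W) P).PosDef) (v : ℝ) {K : Set (ℝ × ℝ)} (hK : IsClosed K)
    (hpos : ∀ y ∈ K, 0 < courseSlope v y) :
    markIntensity (covMatrix (jet W) P) (courseSlope v) K ≤
      ∫⁻ ω, ((seaUpcrossings W v K ω).encard : ℝ≥0∞) ∂P :=
  calc markIntensity (covMatrix (jet W) P) (courseSlope v) K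
      = limsup (fun n => ∫⁻ ω, seaCount W v K n ω ∂P) atTop :=
        (hW.tendsto_lintegral_seaCount hS v hK.measurableSet).limsup_eq.symm
    _ ≤ ∫⁻ ω, limsup (fun n => seaCount W v K n ω) atTop ∂P :=
        limsup_lintegral_le_of_aemeasurable (fun ω => ⨆ n, seaCount W v univ n ω)
          (hW.aemeasurable_seaCount v hK.measurableSet)
          (fun n => ae_of_all _ fun ω => (seaCount_le_seaCount_univ v K n ω).trans
            (le_iSup (fun n => seaCount W v univ n ω) n))
          (hW.lintegral_iSup_seaCount_ne_top hS v)
    _ ≤ ∫⁻ ω, ((seaUpcrossings W v K ω).encard : ℝ≥0∞) ∂P := by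
        refine lintegral_mono_ae ?_
        filter_upwards [hW.contDiff] with ω hω
        exact limsup_le_of_le (by isBoundedDefault) (eventually_seaCount_le_encard hω v hK hpos)

/-- **Rice's formula**: regularity of the finite measure `markIntensity` combines the bounds from
above for open sets and from below for closed ones. -/
theorem IsGaussianSea.lintegral_encard_seaUpcrossings (hW : IsGaussianSea W P)
    (hS : (covMatrix (jet W) P).PosDef) (v : ℝ) {A : Set (ℝ × ℝ)} (hA : MeasurableSet A) :
    ∫⁻ ω, ((seaUpcrossings W v A ω).encard : ℝ≥0∞) ∂P =
      markIntensity (covMatrix (jet W) P) (courseSlope v) A := by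
  have := isFiniteMeasure_markIntensity hS (courseSlope v)
  have hmono : ∀ {B C : Set (ℝ × ℝ)}, B ⊆ C →
      ∫⁻ ω, ((seaUpcrossings W v B ω).encard : ℝ≥0∞) ∂P ≤
        ∫⁻ ω, ((seaUpcrossings W v C ω).encard : ℝ≥0∞) ∂P := fun hBC =>
    lintegral_mono fun ω => ENat.toENNReal_le.2 (encard_le_encard (seaUpcrossings_mono v hBC ω))
  refine le_antisymm ?_ ?_
  · rw [A.measure_eq_iInf_isOpen]
    exact le_iInf₂ fun U hAU => le_iInf fun hU =>
      (hmono hAU).trans (hW.lintegral_encard_seaUpcrossings_le hS v hU)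
  · have hpos : MeasurableSet {y | 0 < courseSlope v y} :=
      measurableSet_lt measurable_const (courseSlope v).measurable
    rw [← measure_inter_conull (markIntensity_compl_pos _ _),
      (hA.inter hpos).measure_eq_iSup_isClosed_of_ne_top (measure_ne_top _ _)]
    exact iSup₂_le fun K hKA => iSup_le fun hK =>
      (hW.le_lintegral_encard_seaUpcrossings hS v hK fun y hy => (hKA hy).2).trans
        (hmono (hKA.trans inter_subset_left))

end RiceFormula

section OvertakingTimes

variable {Ω : Type*} {W : ℝ × ℝ → Ω → ℝ}

theorem overtakingTimes_inter_eq {ω : Ω} (hω : ContDiff ℝ 1 fun p => W p ω) (v : ℝ) (B : Set ℝ) :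
    overtakingTimes W v ω ∩ {t | Wx W (v * t) t ω ∈ B} =
      seaUpcrossings W v (Prod.fst ⁻¹' (Iio 0 ∩ B)) ω := by
  ext t
  have hderiv : deriv (fun s => encSea W v s ω) t =
      courseSlope v (Wx W (v * t) t ω, Wt W (v * t) t ω) :=
    (hasStrictDerivAt_course hω v t).hasDerivAt.deriv
  simp only [overtakingTimes, seaUpcrossings, markedUpcrossings, mem_inter_iff, mem_ofPred_eq,
    mem_preimage, mem_Iio, hderiv, and_assoc]

theorem max_velocity_sub_mul_max_neg (v a b : ℝ) :
    max (velocity a b - v) 0 * max (-a) 0 =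
      (Prod.fst ⁻¹' Iio 0).indicator (fun y => max (courseSlope v y) 0) (a, b) := by
  rcases lt_or_ge a 0 with ha | ha
  · have hslope : (velocity a b - v) * -a = courseSlope v (a, b) := by
      rw [courseSlope_apply, velocity]
      field_simp [ha.ne]
      ring
    rw [indicator_of_mem (by exact ha), max_eq_left (neg_pos.2 ha).le,
      max_mul_of_nonneg _ _ (neg_pos.2 ha).le, zero_mul, hslope]
  · rw [indicator_of_notMem (by exact ha.not_gt), max_eq_right (neg_nonpos.2 ha), mul_zero]

variable [MeasurableSpace Ω] {P : Measure Ω}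

theorem IsGaussianSea.lintegral_encard_overtakingTimes_inter (hW : IsGaussianSea W P)
    (hS : (covMatrix (jet W) P).PosDef) (v : ℝ) {B : Set ℝ} (hB : MeasurableSet B) :
    ∫⁻ ω, ((overtakingTimes W v ω ∩ {t | Wx W (v * t) t ω ∈ B}).encard : ℝ≥0∞) ∂P =
      markIntensity (covMatrix (jet W) P) (courseSlope v) (Prod.fst ⁻¹' (Iio 0 ∩ B)) := by
  rw [← hW.lintegral_encard_seaUpcrossings hS v (measurable_fst (measurableSet_Iio.inter hB))]
  refine lintegral_congr_ae ?_
  filter_upwards [hW.contDiff] with ω hω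
  rw [overtakingTimes_inter_eq hω]

theorem IsGaussianSea.encIntensityLe_eq (hW : IsGaussianSea W P)
    (hS : (covMatrix (jet W) P).PosDef) (v w : ℝ) :
    encIntensityLe W P v w =
      markIntensity (covMatrix (jet W) P) (courseSlope v) (Prod.fst ⁻¹' (Iio 0 ∩ Iic w)) :=
  hW.lintegral_encard_overtakingTimes_inter hS v measurableSet_Iic

theorem IsGaussianSea.encIntensity_eq (hW : IsGaussianSea W P)
    (hS : (covMatrix (jet W) P).PosDef) (v : ℝ) :
    encIntensity W P v =
      markIntensity (covMatrix (jet W) P) (courseSlope v) (Prod.fst ⁻¹' Iio 0) := by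
  rw [← inter_univ (Iio (0 : ℝ)),
    ← hW.lintegral_encard_overtakingTimes_inter hS v MeasurableSet.univ]
  simp only [encIntensity, mem_univ, ofPred_true, inter_univ]

theorem IsGaussianSea.condExpMulDensity_eq (hW : IsGaussianSea W P)
    (hS : (covMatrix (jet W) P).PosDef) (v : ℝ) :
    condExpMulDensity W P (fun a b => max (velocity a b - v) 0 * max (-a) 0) 0 =
      (markIntensity (covMatrix (jet W) P) (courseSlope v) (Prod.fst ⁻¹' Iio 0)).toReal := by
  simp_rw [condExpMulDensity, hW.meanVec_jet, max_velocity_sub_mul_max_neg]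
  exact integral_indicator_max_mul_normalDensity hS.det_pos _ (measurable_fst measurableSet_Iio)

theorem IsGaussianSea.condExpMulDensity_indicator_eq (hW : IsGaussianSea W P)
    (hS : (covMatrix (jet W) P).PosDef) (v : ℝ) {B : Set ℝ} (hB : MeasurableSet B) :
    condExpMulDensity W P
        (fun a b => max (velocity a b - v) 0 * max (-a) 0 * B.indicator 1 a) 0 =
      (markIntensity (covMatrix (jet W) P) (courseSlope v) (Prod.fst ⁻¹' (Iio 0 ∩ B))).toReal := by
  have hweight (a b : ℝ) : max (velocity a b - v) 0 * max (-a) 0 * B.indicator 1 a =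
      (Prod.fst ⁻¹' (Iio 0 ∩ B)).indicator (fun y => max (courseSlope v y) 0) (a, b) := by
    rw [max_velocity_sub_mul_max_neg, preimage_inter, inter_comm, ← indicator_indicator]
    by_cases ha : a ∈ B
    · rw [indicator_of_mem ha, Pi.one_apply, mul_one,
        indicator_of_mem (show (a, b) ∈ Prod.fst ⁻¹' B from ha)]
    · rw [indicator_of_notMem ha, mul_zero,
        indicator_of_notMem (show (a, b) ∉ Prod.fst ⁻¹' B from ha)]
  simp_rw [condExpMulDensity, hW.meanVec_jet, hweight]
  exact integral_indicator_max_mul_normalDensity hS.det_pos _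
    (measurable_fst (measurableSet_Iio.inter hB))

theorem IsGaussianSea.encIntensity_pos (hW : IsGaussianSea W P)
    (hS : (covMatrix (jet W) P).PosDef) (v : ℝ) : 0 < encIntensity W P v := by
  have hslope : 0 < courseSlope v (-1, v + 1) := by rw [courseSlope_apply]; linarith
  rw [hW.encIntensity_eq hS]
  exact markIntensity_pos hS.det_pos (isOpen_Iio.preimage continuous_fst)
    (mem_preimage.2 (by norm_num)) hslope

theorem IsGaussianSea.encIntensity_lt_top (hW : IsGaussianSea W P)
    (hS : (covMatrix (jet W) P).PosDef) (v : ℝ) : encIntensity W P v < ∞ := by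
  have := isFiniteMeasure_markIntensity hS (courseSlope v)
  rw [hW.encIntensity_eq hS]
  exact measure_lt_top _ _

end OvertakingTimes

end GaussianSea

theorem corollary6p1 {Ω : Type*} [MeasurableSpace Ω] (P : MeasureTheory.Measure Ω)
    [MeasureTheory.IsProbabilityMeasure P] (W : ℝ × ℝ → Ω → ℝ)
    (hW : GaussianSea.IsGaussianSea W P)
    (hnondeg : (GaussianSea.covMatrix (GaussianSea.jet W) P).PosDef) (v : ℝ) :
    (0 < GaussianSea.encIntensity W P v ∧ GaussianSea.encIntensity W P v < ⊤) ∧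
    0 < GaussianSea.condExpMulDensity W P
      (fun a b => max (GaussianSea.velocity a b - v) 0 * max (-a) 0) 0 ∧
    ∀ w : ℝ, GaussianSea.encSlopeCDF W P v w =
      GaussianSea.condExpMulDensity W P
        (fun a b => max (GaussianSea.velocity a b - v) 0 * max (-a) 0 *
          Set.indicator (Set.Iic w) 1 a) 0 /
      GaussianSea.condExpMulDensity W P
        (fun a b => max (GaussianSea.velocity a b - v) 0 * max (-a) 0) 0 := by
  have hpos := hW.encIntensity_pos hnondeg v
  have hlt := hW.encIntensity_lt_top hnondeg v
  refine ⟨⟨hpos, hlt⟩, ?_, fun w => ?_⟩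
  · rw [hW.condExpMulDensity_eq hnondeg, ← hW.encIntensity_eq hnondeg]
    exact ENNReal.toReal_pos hpos.ne' hlt.ne
  · rw [hW.condExpMulDensity_eq hnondeg, ← hW.encIntensity_eq hnondeg,
      hW.condExpMulDensity_indicator_eq hnondeg v measurableSet_Iic,
      ← hW.encIntensityLe_eq hnondeg, ← ENNReal.toReal_div, GaussianSea.encSlopeCDF]
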